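/- Let $M=(M_p)_{p\ge 0}$ be a weight sequence, i.e. a sequence of positive real numbers with $M_0=1$, logarithmically convex ($M_p^2\le M_{p-1}M_{p+1}$ for all $p\ge 1$), and with $\lim_{p\to\infty}M_p^{1/p}=\infty$. Put $m_p:=M_{p+1}/M_p$ for $p\ge 0$, and let $\mathbf m:=(m_{p-1})_{p\ge 1}$ be the sequence of quotients. For $t>0$ let $$\nu_{\mathbf m}(t):=\#\{j\ge 0: m_j\le t\},\qquad \omega_M(t):=\sup_{p\ge 0}\log\frac{t^p}{M_p}.$$ $M$ is called strongly regular if it is logarithmically convex and (mg) there is $A>0$ with $M_{p+q}\le A^{p+q}M_pM_q$ for all $p,q\ge 0$; and (snq) there is $B>0$ with $\sum_{q=p}^{\infty}\frac{M_q}{(q+1)M_{q+1}}\le B\,\frac{M_p}{M_{p+1}}$ for all $p\ge 0$. For a real function $f$ that is positive near $\infty$, the upper and lower Matuszewska indices are $$\alpha(f):=\inf\Big\{a\in\mathbb R:\ \exists C>0\ \forall\Lambda>1,\ \limsup_{x\to\infty}\sup_{\lambda\in[1,\Lambda]}\frac{f(\lambda x)}{\lambda^{a}f(x)}\le C\Big\},$$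 $$\beta(f):=\sup\Big\{b\in\mathbb R:\ \exists D>0\ \forall\Lambda>1,\ \liminf_{x\to\infty}\inf_{\lambda\in[1,\Lambda]}\frac{f(\lambda x)}{\lambda^{b}f(x)}\ge D\Big\}$$ in $[-\infty,\infty]$, with $\inf\emptyset=\sup\mathbb R=\infty$ and $\inf\mathbb R=\sup\emptyset=-\infty$. For a sequence $\mathbf a=(a_p)_{p\ge1}$ of positive real numbers, $\alpha(\mathbf a)$ and $\beta(\mathbf a)$ are the indices of the function $x\mapsto a_{\lfloor x\rfloor}$, $x\ge 1$; and $\mathbf a$ is O-regularly varying if $\limsup_{p\to\infty}a_{\lfloor\lambda p\rfloor}/a_p<\infty$ for every $\lambda>0$. Then the following are equivalent: 1. $M$ is strongly regular; 2. there is an integer $k\ge 2$ such that $1<\liminf_{p\to\infty}\frac{m_{kp}}{m_p}\le\limsup_{p\to\infty}\frac{m_{kp}}{m_p}<\infty$; 3. $\alpha(\mathbf m)<\infty$ and $\beta(\mathbf m)>0$; 4. $\mathbf m$ is O-regularly varying and $\beta(\mathbf m)>0$; 5. $0<\liminf_{t\to\infty}\frac{\nu_{\mathbf m}(t)}{\omega_M(t)}\le\limsup_{t\to\infty}\frac{\nu_{\mathbf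 m}(t)}{\omega_M(t)}<\infty$; 6. $\alpha(\nu_{\mathbf m})<\infty$ and $\beta(\nu_{\mathbf m})>0$; 7. $\alpha(\omega_M)<\infty$ and $\beta(\omega_M)>0$. In this case, moreover, $\alpha(\omega_M)=\alpha(\nu_{\mathbf m})=1/\beta(\mathbf m)$ and $\beta(\omega_M)=\beta(\nu_{\mathbf m})=1/\alpha(\mathbf m)$. -/

import Mathlib

open Filter Topology Set

noncomputable section

namespace WeightSeq

/-! ### Sequences `M = (M_p)` with `p ≥ 0` and their growth conditions -/

/-- (lc): `M_p ^ 2 ≤ M_{p-1} M_{p+1}` for all `p ≥ 1`. -/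
def LogConvex (M : ℕ → ℝ) : Prop :=
  ∀ p : ℕ, 1 ≤ p → M p ^ 2 ≤ M (p - 1) * M (p + 1)

/-- (mg): moderate growth. -/
def ModerateGrowth (M : ℕ → ℝ) : Prop :=
  ∃ A : ℝ, 0 < A ∧ ∀ p q : ℕ, M (p + q) ≤ A ^ (p + q) * M p * M q

/-- (snq): the strong nonquasianalyticity condition. The sum over `q ≥ p` is written with the
summation index shifted by `p`; its convergence is part of the condition. -/
def StrongNonquasianalytic (M : ℕ → ℝ) : Prop :=
  ∃ B : ℝ, 0 < B ∧ ∀ p : ℕ,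
    Summable (fun q : ℕ => M (p + q) / (((p + q : ℕ) + 1 : ℝ) * M (p + q + 1))) ∧
    ∑' q : ℕ, M (p + q) / (((p + q : ℕ) + 1 : ℝ) * M (p + q + 1)) ≤ B * (M p / M (p + 1))

/-- A weight sequence: positive, `M_0 = 1`, (lc), and `M_p ^ (1/p) → ∞`. -/
structure IsWeightSequence (M : ℕ → ℝ) : Prop where
  pos : ∀ p, 0 < M p
  zero : M 0 = 1
  logConvex : LogConvex M
  tendsto_root : Tendsto (fun p : ℕ => M p ^ (1 / (p : ℝ))) atTop atTop

/-- A strongly regular sequence: positive, `M_0 = 1`, (lc), (mg) and (snq). -/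
structure IsStronglyRegular (M : ℕ → ℝ) : Prop where
  pos : ∀ p, 0 < M p
  zero : M 0 = 1
  logConvex : LogConvex M
  moderateGrowth : ModerateGrowth M
  snq : StrongNonquasianalytic M

/-- The quotients `m_p = M_{p+1} / M_p`, `p ≥ 0`. -/
def quot (M : ℕ → ℝ) (p : ℕ) : ℝ := M (p + 1) / M p

/-- The sequence of quotients numbered from `1`, that is `(m_{p-1})_{p ≥ 1}`. Its value at `p = 0`
is never relevant. This is the sequence whose regular variation and indices are considered. -/
def quotSeq (M : ℕ → ℝ) (p : ℕ) : ℝ := quot M (p - 1)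

/-- The counting function `ν_m(t) = #{j ≥ 0 : m_j ≤ t}`. For a weight sequence the set is finite,
see `IsWeightSequence.finite_quot_le`. -/
def counting (M : ℕ → ℝ) (t : ℝ) : ℝ := ({j : ℕ | quot M j ≤ t}.ncard : ℝ)

/-- The associated function `ω_M(t) = sup_p log (t ^ p / M_p)`. For a weight sequence the
supremum is finite, see `IsWeightSequence.bddAbove_log`. -/
def assocFun (M : ℕ → ℝ) (t : ℝ) : ℝ := ⨆ p : ℕ, Real.log (t ^ p / M p)

/-! ### Matuszewska indices and O-regular variation

The functions considered are eventually positive; the indices depend only on their values near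
infinity, so functions defined on a half-line are represented by functions on `ℝ`. -/

/-- The upper Matuszewska index, with values in `[-∞, ∞]` and `inf ∅ = ∞`. -/
def upperIndex (f : ℝ → ℝ) : EReal :=
  sInf ((fun a : ℝ => (a : EReal)) '' {a : ℝ | ∃ C : ℝ, 0 < C ∧ ∀ L : ℝ, 1 < L →
    limsup (fun x : ℝ => ⨆ l ∈ Icc 1 L, ((f (l * x) / (l ^ a * f x) : ℝ) : EReal)) atTop
      ≤ (C : EReal)})

/-- The lower Matuszewska index, with values in `[-∞, ∞]` and `sup ∅ = -∞`. -/
def lowerIndex (f : ℝ → ℝ) : EReal :=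
  sSup ((fun b : ℝ => (b : EReal)) '' {b : ℝ | ∃ D : ℝ, 0 < D ∧ ∀ L : ℝ, 1 < L →
    (D : EReal) ≤
      liminf (fun x : ℝ => ⨅ l ∈ Icc 1 L, ((f (l * x) / (l ^ b * f x) : ℝ) : EReal)) atTop})

/-- The step function `f_a(x) = a_{⌊x⌋}`, `x ≥ 1`, of a sequence `(a_p)_{p ≥ 1}`. -/
def stepFun (a : ℕ → ℝ) (x : ℝ) : ℝ := a ⌊x⌋₊

/-- The upper Matuszewska index of a sequence `(a_p)_{p ≥ 1}`. -/
def seqUpperIndex (a : ℕ → ℝ) : EReal := upperIndex (stepFun a)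

/-- The lower Matuszewska index of a sequence `(a_p)_{p ≥ 1}`. -/
def seqLowerIndex (a : ℕ → ℝ) : EReal := lowerIndex (stepFun a)

/-- `(a_p)_{p ≥ 1}` is O-regularly varying: `limsup a_{⌊l p⌋} / a_p < ∞` for every `l > 0`. -/
def SeqORegularlyVarying (a : ℕ → ℝ) : Prop :=
  ∀ l : ℝ, 0 < l →
    limsup (fun p : ℕ => ((a ⌊l * (p : ℝ)⌋₊ / a p : ℝ) : EReal)) atTop < ⊤

/-! ### The two functions attached to a weight sequence are well defined -/

theorem IsWeightSequence.bddAbove_log {M : ℕ → ℝ} (hM : IsWeightSequence M) {t : ℝ}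
    (ht : 0 ≤ t) : BddAbove (range fun p : ℕ => Real.log (t ^ p / M p)) := by
  have h1 : ∀ᶠ p : ℕ in atTop, Real.log (t ^ p / M p) ≤ 0 := by
    filter_upwards [hM.tendsto_root.eventually_ge_atTop t, eventually_ge_atTop 1] with p hp hp1
    have hp0 : (p : ℝ) ≠ 0 := by positivity
    have h2 : t ^ p ≤ M p := by
      calc t ^ p ≤ (M p ^ (1 / (p : ℝ))) ^ p := pow_le_pow_left₀ ht hp p
        _ = M p := by
          rw [← Real.rpow_natCast, ← Real.rpow_mul (hM.pos p).le, one_div_mul_cancel hp0,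
            Real.rpow_one]
    exact Real.log_nonpos (div_nonneg (pow_nonneg ht p) (hM.pos p).le)
      ((div_le_one (hM.pos p)).2 h2)
  exact (isBoundedUnder_of_eventually_le h1).bddAbove_range

theorem IsWeightSequence.assocFun_zero {M : ℕ → ℝ} (hM : IsWeightSequence M) :
    assocFun M 0 = 0 := by
  have h : ∀ p : ℕ, Real.log ((0 : ℝ) ^ p / M p) = 0 := by
    intro p
    cases p with
    | zero => simp [hM.zero]
    | succ p => simp
  simp [assocFun, h]

theorem IsWeightSequence.monotone_quot {M : ℕ → ℝ} (hM : IsWeightSequence M) :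
    Monotone (quot M) := by
  refine monotone_nat_of_le_succ fun p => ?_
  have h := hM.logConvex (p + 1) (by omega)
  simp only [Nat.add_sub_cancel] at h
  unfold quot
  rw [div_le_div_iff₀ (hM.pos p) (hM.pos (p + 1))]
  nlinarith

theorem IsWeightSequence.finite_quot_le {M : ℕ → ℝ} (hM : IsWeightSequence M) (t : ℝ) :
    {j : ℕ | quot M j ≤ t}.Finite := by
  by_contra hinf
  have hall : ∀ j, quot M j ≤ t := by
    intro j
    obtain ⟨i, hi, hji⟩ := (Set.not_finite.1 hinf : Set.Infinite _).exists_gt j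
    exact (hM.monotone_quot hji.le).trans hi
  have ht : 0 < t := lt_of_lt_of_le (div_pos (hM.pos 1) (hM.pos 0)) (hall 0)
  have hle : ∀ p, M p ≤ t ^ p := by
    intro p
    induction p with
    | zero => simp [hM.zero]
    | succ p ih =>
      have h := (div_le_iff₀ (hM.pos p)).1 (hall p)
      calc M (p + 1) ≤ t * M p := h
        _ ≤ t * t ^ p := by gcongr
        _ = t ^ (p + 1) := by ring
  obtain ⟨p, hp, hp1⟩ :=
    ((hM.tendsto_root.eventually_gt_atTop t).and (eventually_ge_atTop 1)).exists
  have hp0 : (p : ℝ) ≠ 0 := by positivity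
  have h3 : M p ^ (1 / (p : ℝ)) ≤ t := by
    calc M p ^ (1 / (p : ℝ)) ≤ (t ^ p) ^ (1 / (p : ℝ)) :=
          Real.rpow_le_rpow (hM.pos p).le (hle p) (by positivity)
      _ = t := by
        rw [← Real.rpow_natCast, ← Real.rpow_mul ht.le, mul_one_div_cancel hp0, Real.rpow_one]
  linarith

end WeightSeq

end

/-!
Write `a` for the step function of the sequence of quotients, `ν` for the counting function and
`ω` for the associated function.

*Indices as exponents of power bounds.* For an eventually positive `f`, the upper index is the
infimum of the exponents `c` with `f (l x) ≤ C l ^ c f x` for all `l ≥ 1` and all `x ≥ x₀`: the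
thresholds depending on the range of `l` in the definition become uniform, at the price of an
arbitrarily small increase of the exponent, by iterating the bound along the powers of one factor
(`powUpper_of_iterate`). The lower index is treated through `1 / f`. For monotone functions, the
existence of a finite (positive) exponent only has to be tested at one factor, which reduces
O-regular variation and the condition on `m_{kp} / m_p` to such bounds.

*Quotients and counting function.* These are generalized inverses of each other, so lower power
bounds of `a` with exponent `b` correspond to upper power bounds of `ν` with exponent `1 / b`, and
vice versa. This gives the reciprocal relations between the indices.

*Counting and associated function.* `ν` is the slope of `ω` as a convex function of `log t`:
`ν(t) log l ≤ ω(l t) - ω(t) ≤ ν(l t) log l`. These two inequalities suffice to show that `ω ≤ K ν`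
near infinity if and only if `ω`, or equivalently `ν`, has a positive lower exponent, and to relate
`ν ≤ K ω` to finite upper exponents. If both hold, then `ν` and `ω` are comparable and have the same
indices.

*Strong regularity.* Moderate growth yields `ω ≤ K ν` through `(m_p) ^ p ≤ M_{2p} / M_p`; conversely
a positive lower exponent of `ω` yields `2 ω(t) ≤ ω(L t) + B`, and moderate growth by conjugation.
Hence moderate growth means a finite upper exponent of `a`. Strong nonquasianalyticity means a
positive lower exponent of `a`: the harmonic sum forces the quotients to double over a bounded ratio
of indices, and conversely a power bound allows comparison with a telescoping series.
-/

namespace WeightSeq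

/-! ### Power bounds and Matuszewska indices -/

/-- `f (l x) ≤ C l ^ a f x` for all `l ≥ 1` and all `x` beyond a threshold which, unlike in the
definition of the upper Matuszewska index, does not depend on the range of `l`. -/
def PowUpper (f : ℝ → ℝ) (a : ℝ) : Prop :=
  ∃ C x₀ : ℝ, 0 < C ∧ 0 < x₀ ∧ ∀ x, x₀ ≤ x → ∀ l, 1 ≤ l → f (l * x) ≤ C * l ^ a * f x

/-- `D l ^ b f x ≤ f (l x)` for all `l ≥ 1` and all `x` beyond a threshold independent of `l`. -/
def PowLower (f : ℝ → ℝ) (b : ℝ) : Prop :=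
  ∃ D x₀ : ℝ, 0 < D ∧ 0 < x₀ ∧ ∀ x, x₀ ≤ x → ∀ l, 1 ≤ l → D * l ^ b * f x ≤ f (l * x)

theorem eventually_pos_threshold {p : ℝ → Prop} (h : ∀ᶠ x in atTop, p x) :
    ∃ x₀ : ℝ, 0 < x₀ ∧ ∀ x, x₀ ≤ x → p x := by
  obtain ⟨y, hy⟩ := eventually_atTop.1 h
  exact ⟨max y 1, by positivity, fun x hx => hy x ((le_max_left _ _).trans hx)⟩

theorem PowUpper.mono {f : ℝ → ℝ} (hf : ∀ᶠ x in atTop, 0 < f x) {a a' : ℝ} (haa : a ≤ a')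
    (h : PowUpper f a) : PowUpper f a' := by
  obtain ⟨C, x₀, hC, hx₀, H⟩ := h
  obtain ⟨x₁, hx₁, hp⟩ := eventually_pos_threshold hf
  refine ⟨C, max x₀ x₁, hC, by positivity, fun x hx l hl => ?_⟩
  have h0 := hp x ((le_max_right _ _).trans hx)
  refine (H x ((le_max_left _ _).trans hx) l hl).trans ?_
  have := Real.rpow_le_rpow_of_exponent_le hl haa
  gcongr

theorem powLower_iff_inv {f : ℝ → ℝ} (hf : ∀ᶠ x in atTop, 0 < f x) {b : ℝ} :
    PowLower f b ↔ PowUpper (fun x => (f x)⁻¹) (-b) := by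
  obtain ⟨x₁, hx₁, hp⟩ := eventually_pos_threshold hf
  have key : ∀ x, x₁ ≤ x → ∀ l : ℝ, 1 ≤ l → ∀ D : ℝ, 0 < D →
      (D * l ^ b * f x ≤ f (l * x) ↔ (f (l * x))⁻¹ ≤ D⁻¹ * l ^ (-b) * (f x)⁻¹) := by
    intro x hx l hl D hD
    have h1 := hp x hx
    have h2 := hp (l * x) (by nlinarith)
    have h3 : 0 < l ^ b := Real.rpow_pos_of_pos (by linarith) b
    rw [Real.rpow_neg (by linarith), ← mul_inv, ← mul_inv, inv_le_inv₀ h2 (by positivity)]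
  constructor
  · rintro ⟨D, x₀, hD, hx₀, H⟩
    refine ⟨D⁻¹, max x₀ x₁, by positivity, by positivity, fun x hx l hl => ?_⟩
    exact (key x ((le_max_right _ _).trans hx) l hl D hD).1
      (H x ((le_max_left _ _).trans hx) l hl)
  · rintro ⟨C, x₀, hC, hx₀, H⟩
    refine ⟨C⁻¹, max x₀ x₁, by positivity, by positivity, fun x hx l hl => ?_⟩
    refine (key x ((le_max_right _ _).trans hx) l hl C⁻¹ (by positivity)).2 ?_
    rw [inv_inv]
    exact H x ((le_max_left _ _).trans hx) l hl

theorem rpow_le_rpow_abs {l L : ℝ} (hl : 1 ≤ l) (hL : l ≤ L) (a : ℝ) : l ^ a ≤ L ^ |a| :=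
  (Real.rpow_le_rpow_of_exponent_le hl (le_abs_self a)).trans
    (Real.rpow_le_rpow (by linarith) hL (abs_nonneg a))

/-- A power bound at the single factor `L`, together with boundedness for factors in `[1, L]`,
propagates to all factors by iteration along the powers of `L`. -/
theorem powUpper_of_iterate {f : ℝ → ℝ} {x₀ L K a : ℝ} (hx₀ : 0 < x₀) (hL : 1 < L) (hK : 0 < K)
    (hf : ∀ x, x₀ ≤ x → 0 < f x)
    (h₁ : ∀ x, x₀ ≤ x → ∀ l, 1 ≤ l → l ≤ L → f (l * x) ≤ K * f x)
    (h₂ : ∀ x, x₀ ≤ x → f (L * x) ≤ L ^ a * f x) : PowUpper f a := by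
  have hL0 : 0 < L := by linarith
  have step : ∀ n : ℕ, ∀ x, x₀ ≤ x → f (L ^ n * x) ≤ (L ^ n) ^ a * f x := by
    intro n
    induction n with
    | zero => intro x _; simp
    | succ n ih =>
      intro x hx
      have h3 : x₀ ≤ L * x := by nlinarith
      calc f (L ^ (n + 1) * x) = f (L ^ n * (L * x)) := by ring_nf
        _ ≤ (L ^ n) ^ a * f (L * x) := ih _ h3
        _ ≤ (L ^ n) ^ a * (L ^ a * f x) := by
          have := h₂ x hx
          gcongr
        _ = (L ^ (n + 1)) ^ a * f x := by
          rw [pow_succ, Real.mul_rpow (by positivity) hL0.le]; ring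
  refine ⟨K * L ^ |a|, x₀, by positivity, hx₀, fun x hx l hl => ?_⟩
  obtain ⟨n, hn, hn'⟩ := exists_nat_pow_near hl hL
  have hLn : 1 ≤ L ^ n := one_le_pow₀ hL.le
  have hLn0 : 0 < L ^ n := by positivity
  have hμ : 1 ≤ l / L ^ n := (one_le_div hLn0).2 hn
  have hμ' : l / L ^ n ≤ L := by
    rw [div_le_iff₀ hLn0]; rw [pow_succ] at hn'; linarith
  have hfx := hf x hx
  have hbd : (L ^ n) ^ a ≤ L ^ |a| * l ^ a := by
    have h4 : (L ^ n) ^ a = (l / L ^ n) ^ (-a) * l ^ a := by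
      rw [Real.rpow_neg (by positivity), Real.div_rpow (by linarith) hLn0.le]
      have : l ^ a ≠ 0 := (Real.rpow_pos_of_pos (by linarith) a).ne'
      field_simp
    rw [h4]
    have := rpow_le_rpow_abs hμ hμ' (-a)
    rw [abs_neg] at this
    have h5 : 0 ≤ l ^ a := Real.rpow_nonneg (by linarith) a
    gcongr
  calc f (l * x) = f (l / L ^ n * (L ^ n * x)) := by
        congr 1; field_simp
    _ ≤ K * f (L ^ n * x) := h₁ _ (by nlinarith) _ hμ hμ'
    _ ≤ K * ((L ^ n) ^ a * f x) := by
      have := step n x hx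
      gcongr
    _ ≤ K * (L ^ |a| * l ^ a * f x) := by gcongr
    _ = K * L ^ |a| * l ^ a * f x := by ring

theorem exists_rpow_eq {K d : ℝ} (hK : 1 < K) (hd : 0 < d) : ∃ L : ℝ, 1 < L ∧ L ^ d = K :=
  ⟨K ^ d⁻¹, Real.one_lt_rpow hK (inv_pos.2 hd),
    Real.rpow_inv_rpow (by linarith) hd.ne'⟩

/-- The bound of the definition of the upper index at the exponent `a` holds at every larger
exponent with a threshold independent of the range of `l`. -/
theorem powUpper_of_local {f : ℝ → ℝ} (hf : ∀ᶠ x in atTop, 0 < f x) {a a' C : ℝ} (haa : a < a')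
    (hC : 0 < C)
    (h : ∀ L : ℝ, 1 < L → ∀ᶠ x in atTop, ∀ l, 1 ≤ l → l ≤ L → f (l * x) ≤ C * l ^ a * f x) :
    PowUpper f a' := by
  obtain ⟨L, hL, hLK⟩ := exists_rpow_eq (K := C + 1) (by linarith) (sub_pos.2 haa)
  obtain ⟨x₀, hx₀, H⟩ := eventually_pos_threshold (hf.and (h L hL))
  refine powUpper_of_iterate hx₀ hL (K := C * L ^ |a|) (by positivity) (fun x hx => (H x hx).1)
    (fun x hx l hl hlL => ?_) (fun x hx => ?_)
  · refine ((H x hx).2 l hl hlL).trans ?_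
    have := rpow_le_rpow_abs hl hlL a
    have := (H x hx).1
    gcongr
  · refine ((H x hx).2 L hL.le le_rfl).trans ?_
    have h1 : L ^ a' = (C + 1) * L ^ a := by
      rw [← hLK, ← Real.rpow_add (by linarith)]; ring_nf
    have := (H x hx).1
    rw [h1]
    gcongr
    linarith

theorem powLower_of_local {f : ℝ → ℝ} (hf : ∀ᶠ x in atTop, 0 < f x) {b b' D : ℝ} (hbb : b' < b)
    (hD : 0 < D)
    (h : ∀ L : ℝ, 1 < L → ∀ᶠ x in atTop, ∀ l, 1 ≤ l → l ≤ L → D * l ^ b * f x ≤ f (l * x)) :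
    PowLower f b' := by
  rw [powLower_iff_inv hf]
  refine powUpper_of_local (hf.mono fun x hx => inv_pos.2 hx) (neg_lt_neg hbb) (inv_pos.2 hD)
    fun L hL => ?_
  filter_upwards [h L hL, hf] with x hx hx0 l hl hlL
  have h3 : 0 < l ^ b := Real.rpow_pos_of_pos (by linarith) b
  rw [Real.rpow_neg (by linarith), ← mul_inv, ← mul_inv]
  exact inv_anti₀ (by positivity) (hx l hl hlL)

theorem upperIndex_eq_sInf {f : ℝ → ℝ} (hf : ∀ᶠ x in atTop, 0 < f x) :
    upperIndex f = sInf ((fun a : ℝ => (a : EReal)) '' {a | PowUpper f a}) := by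
  obtain ⟨x₁, hx₁, hp⟩ := eventually_pos_threshold hf
  have hdiv : ∀ x, x₁ ≤ x → ∀ a l : ℝ, 1 ≤ l → ∀ C : ℝ,
      f (l * x) / (l ^ a * f x) ≤ C ↔ f (l * x) ≤ C * l ^ a * f x := by
    intro x hx a l hl C
    have h1 := hp x hx
    have h3 : 0 < l ^ a := Real.rpow_pos_of_pos (by linarith) a
    rw [div_le_iff₀ (by positivity), mul_assoc]
  unfold upperIndex
  apply le_antisymm
  · refine sInf_le_sInf (image_mono ?_)
    rintro a ⟨C, x₀, hC, hx₀, H⟩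
    refine ⟨C, hC, fun L hL => limsup_le_of_le (by isBoundedDefault) ?_⟩
    filter_upwards [eventually_ge_atTop x₀, eventually_ge_atTop x₁] with x hx hx'
    refine iSup₂_le fun l hl => ?_
    exact_mod_cast (hdiv x hx' a l hl.1 C).2 (H x hx l hl.1)
  · refine le_sInf ?_
    rintro _ ⟨a, ⟨C, hC, H⟩, rfl⟩
    refine le_of_forall_gt fun c hc => ?_
    obtain ⟨a', ha1, ha2⟩ := EReal.lt_iff_exists_real_btwn.1 hc
    refine lt_of_le_of_lt (sInf_le ⟨a', ?_, rfl⟩) ha2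
    refine powUpper_of_local hf (EReal.coe_lt_coe_iff.1 ha1) (C := C + 1) (by linarith)
      fun L hL => ?_
    have h1 : limsup (fun x : ℝ => ⨆ l ∈ Icc 1 L, ((f (l * x) / (l ^ a * f x) : ℝ) : EReal)) atTop
        < ((C + 1 : ℝ) : EReal) :=
      (H L hL).trans_lt (EReal.coe_lt_coe_iff.2 (by linarith))
    filter_upwards [eventually_lt_of_limsup_lt h1, eventually_ge_atTop x₁] with x hx hx' l hl hlL
    refine (hdiv x hx' a l hl _).1 ?_
    have h2 := (le_iSup₂ (f := fun l (_ : l ∈ Icc 1 L) =>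
      ((f (l * x) / (l ^ a * f x) : ℝ) : EReal)) l ⟨hl, hlL⟩).trans hx.le
    exact_mod_cast h2

theorem lowerIndex_eq_sSup {f : ℝ → ℝ} (hf : ∀ᶠ x in atTop, 0 < f x) :
    lowerIndex f = sSup ((fun a : ℝ => (a : EReal)) '' {b | PowLower f b}) := by
  obtain ⟨x₁, hx₁, hp⟩ := eventually_pos_threshold hf
  have hdiv : ∀ x, x₁ ≤ x → ∀ b l : ℝ, 1 ≤ l → ∀ D : ℝ,
      D ≤ f (l * x) / (l ^ b * f x) ↔ D * l ^ b * f x ≤ f (l * x) := by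
    intro x hx b l hl D
    have h1 := hp x hx
    have h3 : 0 < l ^ b := Real.rpow_pos_of_pos (by linarith) b
    rw [le_div_iff₀ (by positivity), mul_assoc]
  unfold lowerIndex
  apply le_antisymm
  · refine sSup_le ?_
    rintro _ ⟨b, ⟨D, hD, H⟩, rfl⟩
    refine le_of_forall_lt fun c hc => ?_
    obtain ⟨b', hb1, hb2⟩ := EReal.lt_iff_exists_real_btwn.1 hc
    refine lt_of_lt_of_le hb1 (le_sSup ⟨b', ?_, rfl⟩)
    refine powLower_of_local hf (EReal.coe_lt_coe_iff.1 hb2) (D := D / 2) (by linarith)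
      fun L hL => ?_
    have h1 : ((D / 2 : ℝ) : EReal) <
        liminf (fun x : ℝ => ⨅ l ∈ Icc 1 L, ((f (l * x) / (l ^ b * f x) : ℝ) : EReal)) atTop :=
      (EReal.coe_lt_coe_iff.2 (by linarith)).trans_le (H L hL)
    filter_upwards [eventually_lt_of_lt_liminf h1, eventually_ge_atTop x₁] with x hx hx' l hl hlL
    refine (hdiv x hx' b l hl _).1 ?_
    have h2 := hx.le.trans (iInf₂_le (f := fun l (_ : l ∈ Icc 1 L) =>
      ((f (l * x) / (l ^ b * f x) : ℝ) : EReal)) l ⟨hl, hlL⟩)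
    exact_mod_cast h2
  · refine sSup_le_sSup (image_mono ?_)
    rintro b ⟨D, x₀, hD, hx₀, H⟩
    refine ⟨D, hD, fun L hL => le_liminf_of_le (by isBoundedDefault) ?_⟩
    filter_upwards [eventually_ge_atTop x₀, eventually_ge_atTop x₁] with x hx hx'
    refine le_iInf₂ fun l hl => ?_
    exact_mod_cast (hdiv x hx' b l hl.1 D).2 (H x hx l hl.1)

theorem upperIndex_lt_top_iff {f : ℝ → ℝ} (hf : ∀ᶠ x in atTop, 0 < f x) :
    upperIndex f < ⊤ ↔ ∃ a, 0 < a ∧ PowUpper f a := by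
  rw [upperIndex_eq_sInf hf]
  constructor
  · intro h
    obtain ⟨_, ⟨a, ha, rfl⟩, -⟩ := sInf_lt_iff.1 h
    exact ⟨max a 1, by positivity, ha.mono hf (le_max_left _ _)⟩
  · rintro ⟨a, -, ha⟩
    exact lt_of_le_of_lt (sInf_le ⟨a, ha, rfl⟩) (EReal.coe_lt_top a)

theorem lowerIndex_pos_iff {f : ℝ → ℝ} (hf : ∀ᶠ x in atTop, 0 < f x) :
    0 < lowerIndex f ↔ ∃ b, 0 < b ∧ PowLower f b := by
  rw [lowerIndex_eq_sSup hf]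
  constructor
  · intro h
    obtain ⟨_, ⟨b, hb, rfl⟩, h0⟩ := lt_sSup_iff.1 h
    exact ⟨b, EReal.coe_pos.1 h0, hb⟩
  · rintro ⟨b, hb0, hb⟩
    exact (EReal.coe_pos.2 hb0).trans_le (le_sSup (mem_image_of_mem _ hb))

/-- The exponents of lower power bounds never exceed those of upper power bounds. -/
theorem PowLower.le_of_powUpper {f : ℝ → ℝ} (hf : ∀ᶠ x in atTop, 0 < f x) {a b : ℝ}
    (hb : PowLower f b) (ha : PowUpper f a) : b ≤ a := by
  obtain ⟨D, x₀, hD, hx₀, H⟩ := hb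
  obtain ⟨C, y₀, hC, hy₀, H'⟩ := ha
  by_contra! hlt
  obtain ⟨x, hx, hxx, hxy⟩ :=
    (hf.and ((eventually_ge_atTop x₀).and (eventually_ge_atTop y₀))).exists
  obtain ⟨l, hl1, hl⟩ := exists_rpow_eq (K := C / D + 1)
    (by have : 0 < C / D := by positivity
        linarith) (sub_pos.2 hlt)
  have h1 := (H x hxx l hl1.le).trans (H' x hxy l hl1.le)
  have hla : 0 < l ^ a := Real.rpow_pos_of_pos (by linarith) a
  have h2 : l ^ b = (C / D + 1) * l ^ a := by
    rw [← hl, ← Real.rpow_add (by linarith)]; ring_nf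
  rw [h2] at h1
  have h3 : D * ((C / D + 1) * l ^ a) * f x = C * l ^ a * f x + D * l ^ a * f x := by
    field_simp
  have h4 : 0 < D * l ^ a * f x := by positivity
  linarith

/-- If the lower exponents of `g` are the reciprocals of the upper exponents of `f`, and `g` has
both kinds of bounds, then the corresponding indices are positive reals inverse to each other. -/
theorem exists_lowerIndex_upperIndex_inv {f g : ℝ → ℝ} (hf : ∀ᶠ x in atTop, 0 < f x)
    (hg : ∀ᶠ x in atTop, 0 < g x) (h : ∀ b, 0 < b → (PowLower g b ↔ PowUpper f b⁻¹))
    (hL : ∃ b, 0 < b ∧ PowLower g b) (hU : ∃ a, PowUpper g a) :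
    ∃ r : ℝ, 0 < r ∧ lowerIndex g = r ∧ upperIndex f = ((r⁻¹ : ℝ) : EReal) := by
  obtain ⟨b₀, hb₀, hb₀'⟩ := hL
  obtain ⟨a₀, ha₀⟩ := hU
  have hbdd : BddAbove {b | PowLower g b} := ⟨a₀, fun b hb => hb.le_of_powUpper hg ha₀⟩
  set r := sSup {b | PowLower g b} with hr
  have hr0 : 0 < r := hb₀.trans_le (le_csSup hbdd hb₀')
  refine ⟨r, hr0, ?_, ?_⟩
  · rw [lowerIndex_eq_sSup hg]
    apply le_antisymm
    · refine sSup_le ?_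
      rintro _ ⟨b, hb, rfl⟩
      exact EReal.coe_le_coe_iff.2 (le_csSup hbdd hb)
    · refine le_of_forall_lt fun c hc => ?_
      obtain ⟨d, hd1, hd2⟩ := EReal.lt_iff_exists_real_btwn.1 hc
      obtain ⟨b, hb, hdb⟩ := exists_lt_of_lt_csSup ⟨b₀, hb₀'⟩ (EReal.coe_lt_coe_iff.1 hd2)
      exact hd1.trans ((EReal.coe_lt_coe_iff.2 hdb).trans_le (le_sSup ⟨b, hb, rfl⟩))
  · rw [upperIndex_eq_sInf hf]
    apply le_antisymm
    · refine le_of_forall_gt fun c hc => ?_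
      obtain ⟨d, hd1, hd2⟩ := EReal.lt_iff_exists_real_btwn.1 hc
      have hd1' : r⁻¹ < d := EReal.coe_lt_coe_iff.1 hd1
      have hd0 : 0 < d := (inv_pos.2 hr0).trans hd1'
      obtain ⟨b, hb, hdb⟩ := exists_lt_of_lt_csSup ⟨b₀, hb₀'⟩ (inv_lt_of_inv_lt₀ hr0 hd1')
      have hb0 : 0 < b := (inv_pos.2 hd0).trans hdb
      refine lt_of_le_of_lt (sInf_le ⟨b⁻¹, (h b hb0).1 hb, rfl⟩) (lt_trans ?_ hd2)
      exact EReal.coe_lt_coe_iff.2 (inv_lt_of_inv_lt₀ hd0 hdb)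
    · refine le_sInf ?_
      rintro _ ⟨c, hc, rfl⟩
      refine EReal.coe_le_coe_iff.2 ?_
      by_contra! hlt
      obtain ⟨c', hc1, hc2⟩ := exists_between (max_lt hlt (inv_pos.2 hr0))
      have hc0 : 0 < c' := (le_max_right _ _).trans_lt hc1
      have h1 : PowUpper f (c'⁻¹)⁻¹ := by
        rw [inv_inv]
        exact hc.mono hf ((le_max_left _ _).trans hc1.le)
      have h2 := le_csSup hbdd ((h _ (inv_pos.2 hc0)).2 h1)
      exact absurd h2 (not_le.2 ((lt_inv_comm₀ hr0 hc0).2 hc2))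

/-! ### Monotone functions and comparable functions -/

theorem exists_powUpper_of_le_mul {f : ℝ → ℝ} {x₀ L K : ℝ} (hx₀ : 0 < x₀) (hL : 1 < L)
    (hmono : MonotoneOn f (Ici x₀)) (hf : ∀ x, x₀ ≤ x → 0 < f x)
    (h : ∀ x, x₀ ≤ x → f (L * x) ≤ K * f x) : ∃ a, 0 < a ∧ PowUpper f a := by
  have hL0 : 0 < L := by linarith
  have hlog := Real.log_pos hL
  refine ⟨Real.log (max K 2) / Real.log L,
    div_pos (Real.log_pos (lt_max_of_lt_right one_lt_two)) hlog, ?_⟩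
  have hK : 0 < max K 2 := by positivity
  have h' : ∀ x, x₀ ≤ x → f (L * x) ≤ max K 2 * f x := fun x hx =>
    (h x hx).trans (mul_le_mul_of_nonneg_right (le_max_left _ _) (hf x hx).le)
  refine powUpper_of_iterate hx₀ hL hK hf (fun x hx l hl hlL => ?_) (fun x hx => ?_)
  · refine le_trans (hmono ?_ ?_ ?_) (h' x hx)
    · exact hx.trans (le_mul_of_one_le_left (hx₀.le.trans hx) hl)
    · exact hx.trans (le_mul_of_one_le_left (hx₀.le.trans hx) hL.le)
    · exact mul_le_mul_of_nonneg_right hlL (hx₀.le.trans hx)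
  · rw [Real.rpow_def_of_pos hL0, mul_div_cancel₀ _ hlog.ne', Real.exp_log hK]
    exact h' x hx

theorem exists_powLower_of_mul_le {f : ℝ → ℝ} {x₀ L q : ℝ} (hx₀ : 0 < x₀) (hL : 1 < L)
    (hq : 1 < q) (hmono : MonotoneOn f (Ici x₀)) (hf : ∀ x, x₀ ≤ x → 0 < f x)
    (h : ∀ x, x₀ ≤ x → q * f x ≤ f (L * x)) : ∃ b, 0 < b ∧ PowLower f b := by
  have hL0 : 0 < L := by linarith
  have hlog := Real.log_pos hL
  refine ⟨Real.log q / Real.log L, div_pos (Real.log_pos hq) hlog, ?_⟩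
  have hfe : ∀ᶠ x in atTop, 0 < f x := (eventually_ge_atTop x₀).mono hf
  rw [powLower_iff_inv hfe]
  refine powUpper_of_iterate hx₀ hL one_pos (fun x hx => inv_pos.2 (hf x hx))
    (fun x hx l hl hlL => ?_) (fun x hx => ?_)
  · have h1 : x ≤ l * x := le_mul_of_one_le_left (hx₀.le.trans hx) hl
    rw [one_mul]
    exact inv_anti₀ (hf x hx) (hmono hx (hx.trans h1) h1)
  · rw [Real.rpow_neg hL0.le, Real.rpow_def_of_pos hL0, mul_div_cancel₀ _ hlog.ne',
      Real.exp_log (by linarith), ← mul_inv]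
    exact inv_anti₀ (mul_pos (by linarith) (hf x hx)) (h x hx)

theorem PowUpper.of_comparable {f g : ℝ → ℝ} {c C a : ℝ} (hc : 0 < c) (hC : 0 < C)
    (h₁ : ∀ᶠ x in atTop, g x ≤ C * f x) (h₂ : ∀ᶠ x in atTop, f x ≤ c * g x)
    (h : PowUpper f a) : PowUpper g a := by
  obtain ⟨K, x₀, hK, hx₀, H⟩ := h
  obtain ⟨x₁, hx₁, H₁⟩ := eventually_pos_threshold (h₁.and h₂)
  refine ⟨C * K * c, max x₀ x₁, by positivity, by positivity, fun x hx l hl => ?_⟩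
  have hx0 := (le_max_left _ _).trans hx
  have hx1 := (le_max_right _ _).trans hx
  have hla : 0 < l ^ a := Real.rpow_pos_of_pos (by linarith) a
  have hlx : x₁ ≤ l * x := hx1.trans (le_mul_of_one_le_left (hx₁.le.trans hx1) hl)
  calc g (l * x) ≤ C * f (l * x) := (H₁ _ hlx).1
    _ ≤ C * (K * l ^ a * f x) := by
      have := H x hx0 l hl
      gcongr
    _ ≤ C * (K * l ^ a * (c * g x)) := by
      have := (H₁ _ hx1).2
      gcongr
    _ = C * K * c * l ^ a * g x := by ring

theorem upperIndex_congr {f g : ℝ → ℝ} {c C : ℝ} (hf : ∀ᶠ x in atTop, 0 < f x)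
    (hg : ∀ᶠ x in atTop, 0 < g x) (hc : 0 < c) (hC : 0 < C)
    (h₁ : ∀ᶠ x in atTop, g x ≤ C * f x) (h₂ : ∀ᶠ x in atTop, f x ≤ c * g x) :
    upperIndex f = upperIndex g := by
  rw [upperIndex_eq_sInf hf, upperIndex_eq_sInf hg]
  congr 2
  ext a
  exact ⟨PowUpper.of_comparable hc hC h₁ h₂, PowUpper.of_comparable hC hc h₂ h₁⟩

theorem lowerIndex_congr {f g : ℝ → ℝ} {c C : ℝ} (hf : ∀ᶠ x in atTop, 0 < f x)
    (hg : ∀ᶠ x in atTop, 0 < g x) (hc : 0 < c) (hC : 0 < C)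
    (h₁ : ∀ᶠ x in atTop, g x ≤ C * f x) (h₂ : ∀ᶠ x in atTop, f x ≤ c * g x) :
    lowerIndex f = lowerIndex g := by
  rw [lowerIndex_eq_sSup hf, lowerIndex_eq_sSup hg]
  congr 2
  ext b
  have key : ∀ {f g : ℝ → ℝ} {c : ℝ}, 0 < c → (∀ᶠ x in atTop, 0 < f x) →
      (∀ᶠ x in atTop, 0 < g x) → (∀ᶠ x in atTop, f x ≤ c * g x) →
      ∀ᶠ x in atTop, (g x)⁻¹ ≤ c * (f x)⁻¹ := by
    intro f g c hc hf hg h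
    filter_upwards [hf, hg, h] with x h1 h2 h3
    rw [inv_le_iff_one_le_mul₀ h2, mul_assoc, inv_mul_eq_div, mul_div_assoc',
      one_le_div h1]
    exact h3
  simp only [mem_ofPred_eq]
  rw [powLower_iff_inv hf, powLower_iff_inv hg]
  exact ⟨PowUpper.of_comparable hC hc (key hc hf hg h₂) (key hC hg hf h₁),
    PowUpper.of_comparable hc hC (key hC hg hf h₁) (key hc hf hg h₂)⟩

/-! ### Extended real limits of real functions -/

theorem limsup_coe_lt_top_iff {α : Type*} {l : Filter α} {u : α → ℝ} :
    limsup (fun x => (u x : EReal)) l < ⊤ ↔ ∃ C : ℝ, ∀ᶠ x in l, u x ≤ C := by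
  constructor
  · intro h
    obtain ⟨C, hC, -⟩ := EReal.lt_iff_exists_real_btwn.1 h
    exact ⟨C, (eventually_lt_of_limsup_lt hC).mono fun x hx => by exact_mod_cast hx.le⟩
  · rintro ⟨C, hC⟩
    refine (limsup_le_of_le (by isBoundedDefault) (a := (C : EReal)) ?_).trans_lt
      (EReal.coe_lt_top C)
    exact hC.mono fun x hx => by exact_mod_cast hx

theorem lt_liminf_coe_iff {α : Type*} {l : Filter α} {u : α → ℝ} {c : ℝ} :
    (c : EReal) < liminf (fun x => (u x : EReal)) l ↔ ∃ d : ℝ, c < d ∧ ∀ᶠ x in l, d ≤ u x := by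
  constructor
  · intro h
    obtain ⟨d, hd1, hd⟩ := EReal.lt_iff_exists_real_btwn.1 h
    exact ⟨d, by exact_mod_cast hd1,
      (eventually_lt_of_lt_liminf hd).mono fun x hx => by exact_mod_cast hx.le⟩
  · rintro ⟨d, hcd, hd⟩
    refine lt_of_lt_of_le (b := (d : EReal)) (by exact_mod_cast hcd)
      (le_liminf_of_le (by isBoundedDefault) ?_)
    exact hd.mono fun x hx => by exact_mod_cast hx

variable {M : ℕ → ℝ}

/-! ### The quotients and their counting function -/

theorem IsWeightSequence.quot_pos (hM : IsWeightSequence M) (p : ℕ) : 0 < quot M p :=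
  div_pos (hM.pos _) (hM.pos _)

theorem IsWeightSequence.exists_lt_quot (hM : IsWeightSequence M) (t : ℝ) :
    ∃ p, t < quot M p := by
  by_contra! h
  exact infinite_univ ((hM.finite_quot_le t).subset fun j _ => h j)

/-- The counting function is the generalized inverse of the quotients: its value at `t` is the
natural number `n` with `quot M j ≤ t` exactly for `j < n`. -/
theorem IsWeightSequence.exists_counting_eq (hM : IsWeightSequence M) (t : ℝ) :
    ∃ n : ℕ, counting M t = n ∧ ∀ j, quot M j ≤ t ↔ j < n := by
  classical
  have hex := hM.exists_lt_quot t
  have key : ∀ j, quot M j ≤ t ↔ j < Nat.find hex := fun j => by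
    constructor
    · intro h
      by_contra! hj
      exact absurd ((Nat.find_spec hex).trans_le (hM.monotone_quot hj)) (not_lt.2 h)
    · intro h
      exact not_lt.1 (Nat.find_min hex h)
  refine ⟨Nat.find hex, ?_, key⟩
  have h1 : {j : ℕ | quot M j ≤ t} = ↑(Finset.range (Nat.find hex)) := by
    ext j
    rw [Finset.coe_range]
    exact key j
  rw [counting, h1, ncard_coe_finset, Finset.card_range]

theorem IsWeightSequence.le_counting (hM : IsWeightSequence M) {p : ℕ} {t : ℝ}
    (h : quot M p ≤ t) : (p : ℝ) + 1 ≤ counting M t := by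
  obtain ⟨n, hn, hj⟩ := hM.exists_counting_eq t
  rw [hn]
  exact_mod_cast (hj p).1 h

theorem IsWeightSequence.counting_le (hM : IsWeightSequence M) {p : ℕ} {t : ℝ}
    (h : t < quot M p) : counting M t ≤ p := by
  obtain ⟨n, hn, hj⟩ := hM.exists_counting_eq t
  rw [hn]
  by_contra! hlt
  exact absurd ((hj p).2 (by exact_mod_cast hlt)) (not_le.2 h)

theorem IsWeightSequence.monotone_counting (hM : IsWeightSequence M) :
    Monotone (counting M) := by
  intro s t hst
  unfold counting
  exact_mod_cast ncard_le_ncard (fun j (hj : quot M j ≤ s) => hj.trans hst) (hM.finite_quot_le t)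

theorem IsWeightSequence.eventually_counting_pos (hM : IsWeightSequence M) :
    ∀ᶠ t in atTop, 0 < counting M t := by
  filter_upwards [eventually_ge_atTop (quot M 0)] with t ht
  have := hM.le_counting ht
  push_cast at this
  linarith

theorem IsWeightSequence.quotSeq_pos (hM : IsWeightSequence M) (p : ℕ) : 0 < quotSeq M p :=
  hM.quot_pos _

theorem IsWeightSequence.stepFun_pos (hM : IsWeightSequence M) (x : ℝ) :
    0 < stepFun (quotSeq M) x := hM.quot_pos _

theorem IsWeightSequence.eventually_stepFun_pos (hM : IsWeightSequence M) :
    ∀ᶠ x in atTop, 0 < stepFun (quotSeq M) x := Eventually.of_forall hM.stepFun_pos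

theorem IsWeightSequence.monotone_quotSeq (hM : IsWeightSequence M) :
    Monotone (quotSeq M) := fun _ _ h => hM.monotone_quot (Nat.sub_le_sub_right h 1)

theorem IsWeightSequence.monotone_stepFun (hM : IsWeightSequence M) :
    Monotone (stepFun (quotSeq M)) := fun _ _ h => hM.monotone_quotSeq (Nat.floor_mono h)

theorem stepFun_natCast (a : ℕ → ℝ) (n : ℕ) : stepFun a n = a n := by simp [stepFun]

theorem stepFun_quotSeq_add_one (p : ℕ) : stepFun (quotSeq M) ((p : ℝ) + 1) = quot M p := by
  have := stepFun_natCast (quotSeq M) (p + 1)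
  push_cast at this
  rw [this]; rfl

/-! ### Inversion of power bounds under passage to the counting function -/

theorem le_rpow_of_mul_rpow_le {u v D b : ℝ} (hu : 0 ≤ u) (hD : 0 < D) (hb : 0 < b)
    (hv : 0 ≤ v) (h : D * u ^ b ≤ v) : u ≤ D⁻¹ ^ b⁻¹ * v ^ b⁻¹ := by
  rw [← Real.mul_rpow (by positivity) hv, Real.le_rpow_inv_iff_of_pos hu (by positivity) hb,
    inv_mul_eq_div, le_div_iff₀ hD, mul_comm]
  exact h

theorem rpow_le_of_le_mul_rpow {u v C b : ℝ} (hu : 0 ≤ u) (hC : 0 < C) (hb : 0 < b)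
    (hv : 0 ≤ v) (h : v ≤ C * u ^ b) : C⁻¹ ^ b⁻¹ * v ^ b⁻¹ ≤ u := by
  rw [← Real.mul_rpow (by positivity) hv, Real.rpow_inv_le_iff_of_pos (by positivity) hu hb,
    inv_mul_eq_div, div_le_iff₀ hC, mul_comm]
  exact h

theorem IsWeightSequence.powUpper_counting (hM : IsWeightSequence M) {b : ℝ} (hb : 0 < b)
    (h : PowLower (stepFun (quotSeq M)) b) : PowUpper (counting M) b⁻¹ := by
  obtain ⟨D, x₀, hD, hx₀, H⟩ := h
  obtain ⟨N, hN⟩ := exists_nat_ge x₀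
  refine ⟨max 1 (2 * D⁻¹ ^ b⁻¹), quot M N, by positivity, hM.quot_pos N, fun t ht μ hμ => ?_⟩
  have ht0 : 0 < t := (hM.quot_pos N).trans_le ht
  obtain ⟨n, hn, hnj⟩ := hM.exists_counting_eq t
  obtain ⟨k, hk, hkj⟩ := hM.exists_counting_eq (μ * t)
  have hNn : N < n := (hnj N).1 ht
  have hμb : 1 ≤ μ ^ b⁻¹ := Real.one_le_rpow hμ (by positivity)
  have hn1 : (1 : ℝ) ≤ n := by exact_mod_cast (by omega : 1 ≤ n)
  have hNn' : (N : ℝ) ≤ n := by exact_mod_cast hNn.le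
  rw [hn, hk]
  rcases le_or_gt k n with hkn | hkn
  · have h1 : (k : ℝ) ≤ n := by exact_mod_cast hkn
    have h2 : 1 ≤ max 1 (2 * D⁻¹ ^ b⁻¹) * μ ^ b⁻¹ :=
      one_le_mul_of_one_le_of_one_le (le_max_left _ _) hμb
    nlinarith
  · have hk1 : (n : ℝ) + 1 ≤ k := by exact_mod_cast hkn
    have h1 := H ((n : ℝ) + 1) (by linarith) ((k : ℝ) / (n + 1))
      ((one_le_div (by positivity)).2 hk1)
    rw [div_mul_cancel₀ _ (by positivity)] at h1
    have h2 := stepFun_quotSeq_add_one (M := M) n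
    have h3 : t < quot M n := not_le.1 fun hh => lt_irrefl n ((hnj n).1 hh)
    have h4 : stepFun (quotSeq M) k ≤ μ * t := by
      rw [stepFun_natCast]
      exact (hkj (k - 1)).2 (by omega)
    rw [h2] at h1
    have h5 : D * ((k : ℝ) / (n + 1)) ^ b ≤ μ := by
      refine le_of_mul_le_mul_right ?_ ht0
      refine le_trans ?_ (h1.trans h4)
      gcongr
    have h6 := le_rpow_of_mul_rpow_le (by positivity) hD hb (by linarith) h5
    rw [div_le_iff₀ (by positivity)] at h6
    refine h6.trans ?_
    calc D⁻¹ ^ b⁻¹ * μ ^ b⁻¹ * ((n : ℝ) + 1) ≤ D⁻¹ ^ b⁻¹ * μ ^ b⁻¹ * (2 * n) := by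
          gcongr
          linarith
      _ = 2 * D⁻¹ ^ b⁻¹ * μ ^ b⁻¹ * n := by ring
      _ ≤ _ := by
          gcongr
          exact le_max_right _ _

theorem IsWeightSequence.powLower_counting (hM : IsWeightSequence M) {b : ℝ} (hb : 0 < b)
    (h : PowUpper (stepFun (quotSeq M)) b) : PowLower (counting M) b⁻¹ := by
  obtain ⟨C, x₀, hC, hx₀, H⟩ := h
  obtain ⟨N, hN⟩ := exists_nat_ge x₀
  refine ⟨C⁻¹ ^ b⁻¹ / 2, quot M N, by positivity, hM.quot_pos N, fun t ht μ hμ => ?_⟩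
  have ht0 : 0 < t := (hM.quot_pos N).trans_le ht
  obtain ⟨n, hn, hnj⟩ := hM.exists_counting_eq t
  obtain ⟨k, hk, hkj⟩ := hM.exists_counting_eq (μ * t)
  have hNn : N < n := (hnj N).1 ht
  have hn1 : (1 : ℝ) ≤ n := by exact_mod_cast (by omega : 1 ≤ n)
  have hNn' : (N : ℝ) ≤ n := by exact_mod_cast hNn.le
  have hnk : n ≤ k := by
    have := hM.monotone_counting (le_mul_of_one_le_left ht0.le hμ)
    rw [hn, hk] at this
    exact_mod_cast this
  have hnk' : (n : ℝ) ≤ k := by exact_mod_cast hnk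
  rw [hn, hk]
  have h1 := H n (by linarith) (((k : ℝ) + 1) / n) ((one_le_div (by positivity)).2 (by linarith))
  rw [div_mul_cancel₀ _ (by positivity)] at h1
  have h2 := stepFun_quotSeq_add_one (M := M) k
  have h3 : μ * t < quot M k := not_le.1 fun hh => lt_irrefl k ((hkj k).1 hh)
  have h4 : stepFun (quotSeq M) n ≤ t := by
    rw [stepFun_natCast]
    exact (hnj (n - 1)).2 (by omega)
  rw [h2] at h1
  have h5 : μ ≤ C * (((k : ℝ) + 1) / n) ^ b := by
    refine le_of_mul_le_mul_right ?_ ht0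
    refine h3.le.trans (h1.trans ?_)
    gcongr
  have h6 := rpow_le_of_le_mul_rpow (by positivity) hC hb (by linarith) h5
  rw [le_div_iff₀ (by positivity)] at h6
  linarith

/-- Power bounds for a sequence, tested at natural numbers, pass to its step function. -/
theorem IsWeightSequence.powLower_stepFun_of_nat (hM : IsWeightSequence M) {D b : ℝ} {N : ℕ}
    (hD : 0 < D) (hb : 0 < b)
    (h : ∀ n k : ℕ, N ≤ n → 1 ≤ n → n ≤ k →
      D * ((k : ℝ) / n) ^ b * quotSeq M n ≤ quotSeq M k) :
    PowLower (stepFun (quotSeq M)) b := by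
  refine ⟨D * (1 / 2) ^ b, N + 1, by positivity, by positivity, fun x hx l hl => ?_⟩
  have hx0 : 0 < x := by
    have : (0 : ℝ) ≤ N := by positivity
    linarith
  have hNx : N + 1 ≤ ⌊x⌋₊ := Nat.le_floor (by exact_mod_cast hx)
  have hxl : x ≤ l * x := le_mul_of_one_le_left hx0.le hl
  have h1 := h ⌊x⌋₊ ⌊l * x⌋₊ (by omega) (by omega) (Nat.floor_mono hxl)
  refine le_trans ?_ h1
  have hf0 : (0 : ℝ) < ⌊x⌋₊ := by exact_mod_cast (by omega : 0 < ⌊x⌋₊)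
  have hf1 : (1 : ℝ) ≤ ⌊l * x⌋₊ := by
    exact_mod_cast (by omega : 1 ≤ ⌊x⌋₊).trans (Nat.floor_mono hxl)
  have h2 : 1 / 2 * l ≤ (⌊l * x⌋₊ : ℝ) / ⌊x⌋₊ := by
    rw [le_div_iff₀ hf0]
    have h3 := Nat.lt_floor_add_one (l * x)
    have h4 := Nat.floor_le hx0.le
    nlinarith
  have h5 : (1 / 2) ^ b * l ^ b ≤ ((⌊l * x⌋₊ : ℝ) / ⌊x⌋₊) ^ b := by
    rw [← Real.mul_rpow (by norm_num) (by linarith)]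
    exact Real.rpow_le_rpow (by positivity) h2 hb.le
  have h6 : 0 < quotSeq M ⌊x⌋₊ := hM.quot_pos _
  calc D * (1 / 2) ^ b * l ^ b * stepFun (quotSeq M) x
      = D * ((1 / 2) ^ b * l ^ b) * quotSeq M ⌊x⌋₊ := by rw [stepFun]; ring
    _ ≤ _ := by gcongr

theorem IsWeightSequence.powUpper_stepFun_of_nat (hM : IsWeightSequence M) {C b : ℝ} {N : ℕ}
    (hC : 0 < C) (hb : 0 < b)
    (h : ∀ n k : ℕ, N ≤ n → 1 ≤ n → n ≤ k →
      quotSeq M k ≤ C * ((k : ℝ) / n) ^ b * quotSeq M n) :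
    PowUpper (stepFun (quotSeq M)) b := by
  refine ⟨C * 2 ^ b, N + 1, by positivity, by positivity, fun x hx l hl => ?_⟩
  have hx0 : 0 < x := by
    have : (0 : ℝ) ≤ N := by positivity
    linarith
  have hNx : N + 1 ≤ ⌊x⌋₊ := Nat.le_floor (by exact_mod_cast hx)
  have hxl : x ≤ l * x := le_mul_of_one_le_left hx0.le hl
  have h1 := h ⌊x⌋₊ ⌊l * x⌋₊ (by omega) (by omega) (Nat.floor_mono hxl)
  refine h1.trans ?_
  have hf0 : (1 : ℝ) ≤ ⌊x⌋₊ := by exact_mod_cast (by omega : 1 ≤ ⌊x⌋₊)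
  have h2 : (⌊l * x⌋₊ : ℝ) / ⌊x⌋₊ ≤ 2 * l := by
    rw [div_le_iff₀ (by linarith)]
    have h3 := Nat.floor_le (hx0.le.trans hxl)
    have h4 := Nat.lt_floor_add_one x
    nlinarith
  have h5 : ((⌊l * x⌋₊ : ℝ) / ⌊x⌋₊) ^ b ≤ 2 ^ b * l ^ b := by
    rw [← Real.mul_rpow (by norm_num) (by linarith)]
    exact Real.rpow_le_rpow (by positivity) h2 hb.le
  have h6 : 0 < quotSeq M ⌊x⌋₊ := hM.quot_pos _
  calc C * ((⌊l * x⌋₊ : ℝ) / ⌊x⌋₊) ^ b * quotSeq M ⌊x⌋₊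
      ≤ C * (2 ^ b * l ^ b) * quotSeq M ⌊x⌋₊ := by gcongr
    _ = C * 2 ^ b * l ^ b * stepFun (quotSeq M) x := by rw [stepFun]; ring

theorem IsWeightSequence.exists_le_quotSeq (hM : IsWeightSequence M) (t : ℝ) :
    ∃ N, ∀ n, N ≤ n → t ≤ quotSeq M n := by
  obtain ⟨N, hN⟩ := hM.exists_lt_quot t
  exact ⟨N + 1, fun n hn => hN.le.trans (hM.monotone_quot (by omega))⟩

theorem IsWeightSequence.powLower_stepFun (hM : IsWeightSequence M) {c : ℝ} (hc : 0 < c)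
    (h : PowUpper (counting M) c) : PowLower (stepFun (quotSeq M)) c⁻¹ := by
  obtain ⟨C, t₀, hC, ht₀, H⟩ := h
  obtain ⟨N, hN⟩ := hM.exists_le_quotSeq (2 * t₀)
  refine hM.powLower_stepFun_of_nat (N := N) (D := C⁻¹ ^ c⁻¹ / 2) (by positivity)
    (by positivity) fun n k hn hn1 hnk => ?_
  have ha : 0 < quotSeq M n := hM.quot_pos _
  have hak : quotSeq M n ≤ quotSeq M k := hM.monotone_quotSeq hnk
  have hn0 : (1 : ℝ) ≤ n := by exact_mod_cast hn1
  -- The counting function is less than `n` at any point below `quotSeq M n`; half of it is taken.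
  have h1 := H (quotSeq M n / 2) (by linarith [hN n hn]) (2 * quotSeq M k / quotSeq M n)
    ((one_le_div ha).2 (by linarith))
  have h2 : 2 * quotSeq M k / quotSeq M n * (quotSeq M n / 2) = quotSeq M k := by field_simp
  rw [h2] at h1
  have h3 : (k : ℝ) ≤ counting M (quotSeq M k) := by
    have := hM.le_counting (p := k - 1) (t := quotSeq M k) le_rfl
    rwa [Nat.cast_sub (by omega), Nat.cast_one, sub_add_cancel] at this
  have h4 : counting M (quotSeq M n / 2) ≤ n := by
    refine (hM.counting_le (p := n - 1) ?_).trans (by exact_mod_cast Nat.sub_le n 1)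
    change quotSeq M n / 2 < quotSeq M n
    linarith
  have h5 : (k : ℝ) / n ≤ C * (2 * quotSeq M k / quotSeq M n) ^ c := by
    rw [div_le_iff₀ (by linarith)]
    refine h3.trans (h1.trans ?_)
    have h7 : 0 ≤ (2 * quotSeq M k / quotSeq M n) ^ c :=
      Real.rpow_nonneg (div_nonneg (by linarith) ha.le) c
    gcongr
  have h6 := rpow_le_of_le_mul_rpow (div_nonneg (by linarith) ha.le) hC hc (by positivity) h5
  rw [le_div_iff₀ ha] at h6
  linarith

theorem IsWeightSequence.powUpper_stepFun (hM : IsWeightSequence M) {c : ℝ} (hc : 0 < c)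
    (h : PowLower (counting M) c) : PowUpper (stepFun (quotSeq M)) c⁻¹ := by
  obtain ⟨D, t₀, hD, ht₀, H⟩ := h
  obtain ⟨N, hN⟩ := hM.exists_le_quotSeq t₀
  refine hM.powUpper_stepFun_of_nat (N := N) (C := max 2 (2 * D⁻¹ ^ c⁻¹)) (by positivity)
    (by positivity) fun n k hn hn1 hnk => ?_
  have ha : 0 < quotSeq M n := hM.quot_pos _
  have hak : quotSeq M n ≤ quotSeq M k := hM.monotone_quotSeq hnk
  have hn0 : (1 : ℝ) ≤ n := by exact_mod_cast hn1
  have hk0 : (n : ℝ) ≤ k := by exact_mod_cast hnk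
  rcases le_or_gt (quotSeq M n) (quotSeq M k / 2) with hle | hgt
  · have h1 := H (quotSeq M n) (hN n hn) (quotSeq M k / 2 / quotSeq M n)
      ((one_le_div ha).2 hle)
    rw [div_mul_cancel₀ _ ha.ne'] at h1
    have h3 : (n : ℝ) ≤ counting M (quotSeq M n) := by
      have := hM.le_counting (p := n - 1) (t := quotSeq M n) le_rfl
      rwa [Nat.cast_sub (by omega), Nat.cast_one, sub_add_cancel] at this
    have h4 : counting M (quotSeq M k / 2) ≤ k := by
      refine (hM.counting_le (p := k - 1) ?_).trans (by exact_mod_cast Nat.sub_le k 1)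
      change quotSeq M k / 2 < quotSeq M k
      linarith
    have h0 : 0 ≤ quotSeq M k / 2 / quotSeq M n := div_nonneg (by linarith) ha.le
    have h5 : D * (quotSeq M k / 2 / quotSeq M n) ^ c ≤ (k : ℝ) / n := by
      rw [le_div_iff₀ (by linarith)]
      refine le_trans ?_ (h1.trans h4)
      gcongr
    have h6 := le_rpow_of_mul_rpow_le h0 hD hc (by positivity) h5
    rw [div_le_iff₀ ha] at h6
    calc quotSeq M k ≤ 2 * D⁻¹ ^ c⁻¹ * ((k : ℝ) / n) ^ c⁻¹ * quotSeq M n := by linarith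
      _ ≤ _ := by
        gcongr
        exact le_max_right _ _
  · have h1 : 1 ≤ ((k : ℝ) / n) ^ c⁻¹ :=
      Real.one_le_rpow ((one_le_div (by linarith)).2 hk0) (by positivity)
    have h2 : 2 * 1 ≤ max 2 (2 * D⁻¹ ^ c⁻¹) * ((k : ℝ) / n) ^ c⁻¹ := by
      gcongr
      exact le_max_left _ _
    nlinarith

/-! ### The associated function -/

theorem IsWeightSequence.log_le_assocFun (hM : IsWeightSequence M) {t : ℝ} (ht : 0 < t) (p : ℕ) :
    p * Real.log t - Real.log (M p) ≤ assocFun M t := by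
  have := le_ciSup (hM.bddAbove_log ht.le) p
  rwa [Real.log_div (pow_pos ht p).ne' (hM.pos p).ne', Real.log_pow] at this

theorem IsWeightSequence.log_succ (hM : IsWeightSequence M) (p : ℕ) :
    Real.log (M (p + 1)) = Real.log (M p) + Real.log (quot M p) := by
  rw [quot, Real.log_div (hM.pos _).ne' (hM.pos _).ne']
  ring

/-- The supremum defining the associated function at `t` is attained at every index where the
quotients cross `t`. -/
theorem IsWeightSequence.assocFun_eq (hM : IsWeightSequence M) {t : ℝ} (ht : 0 < t) {p : ℕ}
    (h₁ : ∀ j, j < p → quot M j ≤ t) (h₂ : t ≤ quot M p) :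
    assocFun M t = p * Real.log t - Real.log (M p) := by
  refine le_antisymm (ciSup_le fun q => ?_) (hM.log_le_assocFun ht p)
  rw [Real.log_div (pow_pos ht q).ne' (hM.pos q).ne', Real.log_pow]
  rcases le_total p q with hpq | hqp
  · induction q, hpq using Nat.le_induction with
    | base => exact le_rfl
    | succ q hq ih =>
      have h3 := Real.log_le_log ht (h₂.trans (hM.monotone_quot hq))
      rw [hM.log_succ]
      push_cast
      linarith
  · induction hqp using Nat.decreasingInduction with
    | self => exact le_rfl
    | of_succ q hq ih =>
      have h3 := Real.log_le_log (hM.quot_pos q) (h₁ q hq)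
      rw [hM.log_succ] at ih
      push_cast at ih
      linarith

theorem IsWeightSequence.assocFun_eq_counting (hM : IsWeightSequence M) {t : ℝ} (ht : 0 < t) :
    ∃ n : ℕ, counting M t = n ∧ t < quot M n ∧
      assocFun M t = n * Real.log t - Real.log (M n) := by
  obtain ⟨n, hn, hj⟩ := hM.exists_counting_eq t
  have h2 : t < quot M n := not_le.1 fun hh => lt_irrefl n ((hj n).1 hh)
  exact ⟨n, hn, h2, hM.assocFun_eq ht (fun j h => (hj j).2 h) h2.le⟩

/-- The counting function is a subgradient of the associated function in the variable `log t`. -/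
theorem IsWeightSequence.counting_mul_log_le (hM : IsWeightSequence M) {t l : ℝ} (ht : 0 < t)
    (hl : 0 < l) : counting M t * Real.log l ≤ assocFun M (l * t) - assocFun M t := by
  obtain ⟨n, hn, -, hω⟩ := hM.assocFun_eq_counting ht
  have := hM.log_le_assocFun (mul_pos hl ht) n
  rw [Real.log_mul hl.ne' ht.ne'] at this
  rw [hn, hω]
  linarith

theorem IsWeightSequence.sub_le_counting_mul_log (hM : IsWeightSequence M) {t l : ℝ} (ht : 0 < t)
    (hl : 0 < l) : assocFun M (l * t) - assocFun M t ≤ counting M (l * t) * Real.log l := by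
  have h := hM.counting_mul_log_le (mul_pos hl ht) (inv_pos.2 hl)
  rw [inv_mul_cancel_left₀ hl.ne', Real.log_inv] at h
  linarith

theorem counting_nonneg (t : ℝ) : 0 ≤ counting M t := Nat.cast_nonneg _

theorem IsWeightSequence.assocFun_nonneg (hM : IsWeightSequence M) {t : ℝ} (ht : 0 < t) :
    0 ≤ assocFun M t := by
  have := hM.log_le_assocFun ht 0
  simpa [hM.zero] using this

theorem IsWeightSequence.assocFun_mono (hM : IsWeightSequence M) {s t : ℝ} (hs : 0 < s)
    (hst : s ≤ t) : assocFun M s ≤ assocFun M t := by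
  have h := hM.counting_mul_log_le hs (l := t / s) (div_pos (hs.trans_le hst) hs)
  rw [div_mul_cancel₀ _ hs.ne'] at h
  have := mul_nonneg (counting_nonneg (M := M) s) (Real.log_nonneg ((one_le_div hs).2 hst))
  linarith

theorem IsWeightSequence.eventually_assocFun_pos (hM : IsWeightSequence M) :
    ∀ᶠ t in atTop, 0 < assocFun M t := by
  filter_upwards [eventually_ge_atTop (2 * quot M 0)] with t ht
  have h0 := hM.quot_pos 0
  have h := hM.counting_mul_log_le (t := t / 2) (by linarith) two_pos
  rw [mul_div_cancel₀ t two_ne_zero] at h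
  have h1 := hM.le_counting (p := 0) (t := t / 2) (by linarith)
  have h2 := hM.assocFun_nonneg (t := t / 2) (by linarith)
  have h3 := Real.log_pos one_lt_two
  push_cast at h1
  nlinarith

/-! ### Comparison of the associated and the counting function -/

theorem exists_two_mul_le {f : ℝ → ℝ} (hf : ∀ᶠ x in atTop, 0 < f x)
    (h : ∃ b, 0 < b ∧ PowLower f b) :
    ∃ L x₀ : ℝ, 1 < L ∧ 0 < x₀ ∧ ∀ x, x₀ ≤ x → 0 < f x ∧ 2 * f x ≤ f (L * x) := by
  obtain ⟨b, hb, D, x₀, hD, hx₀, H⟩ := h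
  obtain ⟨x₁, hx₁, hp⟩ := eventually_pos_threshold hf
  obtain ⟨L, hL, hLb⟩ := exists_rpow_eq (K := max (2 / D) 2) (lt_max_of_lt_right one_lt_two) hb
  refine ⟨L, max x₀ x₁, hL, by positivity, fun x hx => ?_⟩
  have h0 := hp x ((le_max_right _ _).trans hx)
  refine ⟨h0, le_trans ?_ (H x ((le_max_left _ _).trans hx) L hL.le)⟩
  have h1 : 2 / D ≤ L ^ b := hLb ▸ le_max_left _ _
  rw [div_le_iff₀ hD, mul_comm] at h1
  gcongr

theorem exists_le_mul_of_powUpper {f : ℝ → ℝ} (h : ∃ a, 0 < a ∧ PowUpper f a) {L : ℝ}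
    (hL : 1 ≤ L) : ∃ K x₀ : ℝ, 0 < K ∧ 0 < x₀ ∧ ∀ x, x₀ ≤ x → f (L * x) ≤ K * f x := by
  obtain ⟨a, ha, C, x₀, hC, hx₀, H⟩ := h
  exact ⟨C * L ^ a, x₀, by positivity, hx₀, fun x hx => H x hx L hL⟩

theorem IsWeightSequence.assocFun_le_of_powLower_assocFun (hM : IsWeightSequence M)
    (h : ∃ b, 0 < b ∧ PowLower (assocFun M) b) :
    ∃ K, 0 < K ∧ ∀ᶠ t in atTop, assocFun M t ≤ K * counting M t := by
  obtain ⟨L, x₀, hL, hx₀, H⟩ := exists_two_mul_le hM.eventually_assocFun_pos h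
  have hL0 : 0 < L := by linarith
  have hlog := Real.log_pos hL
  refine ⟨2 * Real.log L, by positivity, ?_⟩
  filter_upwards [eventually_ge_atTop (x₀ * L)] with t ht
  have h1 : x₀ ≤ t / L := (le_div_iff₀ hL0).2 ht
  have h2 := (H _ h1).2
  have h3 := hM.sub_le_counting_mul_log (hx₀.trans_le h1) hL0
  rw [mul_div_cancel₀ t hL0.ne'] at h2 h3
  linarith

theorem IsWeightSequence.powLower_counting_of_le (hM : IsWeightSequence M)
    (h : ∃ K, 0 < K ∧ ∀ᶠ t in atTop, assocFun M t ≤ K * counting M t) :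
    ∃ b, 0 < b ∧ PowLower (counting M) b := by
  obtain ⟨K, hK, h⟩ := h
  obtain ⟨x₀, hx₀, H⟩ := eventually_pos_threshold (h.and hM.eventually_counting_pos)
  have hL : 1 < Real.exp (2 * K) := Real.one_lt_exp_iff.2 (by linarith)
  refine exists_powLower_of_mul_le hx₀ hL one_lt_two (hM.monotone_counting.monotoneOn _)
    (fun x hx => (H x hx).2) fun x hx => ?_
  have hx0 := hx₀.trans_le hx
  have h1 := hM.counting_mul_log_le hx0 (Real.exp_pos (2 * K))
  rw [Real.log_exp] at h1
  have h2 := (H (Real.exp (2 * K) * x) (hx.trans (le_mul_of_one_le_left hx0.le hL.le))).1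
  have h3 := hM.assocFun_nonneg hx0
  nlinarith

theorem IsWeightSequence.powLower_assocFun_of_le (hM : IsWeightSequence M)
    (h : ∃ K, 0 < K ∧ ∀ᶠ t in atTop, assocFun M t ≤ K * counting M t) :
    ∃ b, 0 < b ∧ PowLower (assocFun M) b := by
  obtain ⟨K, hK, h⟩ := h
  obtain ⟨x₀, hx₀, H⟩ := eventually_pos_threshold (h.and hM.eventually_assocFun_pos)
  refine exists_powLower_of_mul_le hx₀ (Real.one_lt_exp_iff.2 hK) one_lt_two
    (fun s hs t _ hst => hM.assocFun_mono (hx₀.trans_le hs) hst)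
    (fun x hx => (H x hx).2) fun x hx => ?_
  have h1 := hM.counting_mul_log_le (hx₀.trans_le hx) (Real.exp_pos K)
  rw [Real.log_exp] at h1
  linarith [(H x hx).1]

/-- If `ν (L t) ≥ 2 ν t`, the bound `ω ≤ K ν` on an interval `[t₀, L t₀]` propagates to the
intervals `[L ^ n t₀, L ^ (n + 1) t₀]`, since `ω (L t) - ω t ≤ ν (L t) log L`. -/
theorem IsWeightSequence.assocFun_le_of_powLower_counting (hM : IsWeightSequence M)
    (h : ∃ b, 0 < b ∧ PowLower (counting M) b) :
    ∃ K, 0 < K ∧ ∀ᶠ t in atTop, assocFun M t ≤ K * counting M t := by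
  obtain ⟨L, x₀, hL, hx₀, H⟩ := exists_two_mul_le hM.eventually_counting_pos h
  have hL0 : 0 < L := by linarith
  have hlog := Real.log_pos hL
  set K := max (2 * Real.log L) (assocFun M (L * x₀) / counting M x₀) with hK
  have hν₀ := (H x₀ le_rfl).1
  have hK0 : 0 < K := lt_max_of_lt_left (by positivity)
  have key : ∀ n : ℕ, ∀ s, x₀ ≤ s → s ≤ L * x₀ →
      assocFun M (L ^ n * s) ≤ K * counting M (L ^ n * s) := by
    intro n s hs hsL
    induction n with
    | zero =>
      rw [pow_zero, one_mul]
      have h1 : assocFun M (L * x₀) ≤ K * counting M x₀ :=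
        (div_le_iff₀ hν₀).1 (le_max_right _ _)
      have h2 := hM.assocFun_mono (hx₀.trans_le hs) hsL
      have h3 := hM.monotone_counting hs
      nlinarith
    | succ n ih =>
      have hs0 : 0 < s := hx₀.trans_le hs
      have h1 : x₀ ≤ L ^ n * s := hs.trans (le_mul_of_one_le_left hs0.le (one_le_pow₀ hL.le))
      have h2 := (H _ h1).2
      have h3 := hM.sub_le_counting_mul_log (hx₀.trans_le h1) hL0
      have h4 : 2 * Real.log L ≤ K := le_max_left _ _
      have h5 := counting_nonneg (M := M) (L * (L ^ n * s))
      rw [pow_succ', mul_assoc]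
      nlinarith
  refine ⟨K, hK0, ?_⟩
  filter_upwards [eventually_ge_atTop x₀] with t ht
  obtain ⟨n, hn, hn'⟩ := exists_nat_pow_near ((one_le_div hx₀).2 ht) hL
  have hLn : 0 < L ^ n := by positivity
  have h1 := key n (t / L ^ n) ?_ ?_
  · rwa [mul_div_cancel₀ t hLn.ne'] at h1
  · rw [le_div_iff₀ hx₀] at hn
    rw [le_div_iff₀ hLn]
    linarith
  · rw [div_lt_iff₀ hx₀, pow_succ] at hn'
    rw [div_le_iff₀ hLn]
    linarith

theorem IsWeightSequence.counting_le_of_powUpper_assocFun (hM : IsWeightSequence M)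
    (h : ∃ a, 0 < a ∧ PowUpper (assocFun M) a) :
    ∃ K, 0 < K ∧ ∀ᶠ t in atTop, counting M t ≤ K * assocFun M t := by
  obtain ⟨K, x₀, hK, hx₀, H⟩ :=
    exists_le_mul_of_powUpper h (Real.one_lt_exp_iff.2 one_pos).le
  refine ⟨K, hK, ?_⟩
  filter_upwards [eventually_ge_atTop x₀] with t ht
  have h1 := hM.counting_mul_log_le (hx₀.trans_le ht) (Real.exp_pos 1)
  rw [Real.log_exp] at h1
  linarith [H t ht, hM.assocFun_nonneg (hx₀.trans_le ht)]

theorem IsWeightSequence.counting_le_of_powUpper_counting (hM : IsWeightSequence M)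
    (h : ∃ a, 0 < a ∧ PowUpper (counting M) a) :
    ∃ K, 0 < K ∧ ∀ᶠ t in atTop, counting M t ≤ K * assocFun M t := by
  obtain ⟨K, x₀, hK, hx₀, H⟩ :=
    exists_le_mul_of_powUpper h (Real.one_lt_exp_iff.2 one_pos).le
  refine ⟨K, hK, ?_⟩
  filter_upwards [eventually_ge_atTop (x₀ * Real.exp 1)] with t ht
  have he := Real.exp_pos 1
  have h0 : x₀ ≤ t / Real.exp 1 := (le_div_iff₀ he).2 ht
  have h1 := hM.counting_mul_log_le (hx₀.trans_le h0) he
  have h2 := H _ h0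
  rw [mul_div_cancel₀ t he.ne'] at h1 h2
  rw [Real.log_exp] at h1
  have h3 := hM.assocFun_nonneg (hx₀.trans_le h0)
  nlinarith

theorem IsWeightSequence.powUpper_assocFun_of_le (hM : IsWeightSequence M)
    (h : ∃ K, 0 < K ∧ ∀ᶠ t in atTop, counting M t ≤ K * assocFun M t) :
    ∃ a, 0 < a ∧ PowUpper (assocFun M) a := by
  obtain ⟨K, hK, h⟩ := h
  obtain ⟨x₀, hx₀, H⟩ := eventually_pos_threshold (h.and hM.eventually_assocFun_pos)
  have hL : 1 < Real.exp (2 * K)⁻¹ := Real.one_lt_exp_iff.2 (by positivity)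
  -- With this factor `L`, `ω (L t) - ω t ≤ K log L ω (L t) = ω (L t) / 2`.
  refine exists_powUpper_of_le_mul (K := 2) hx₀ hL
    (fun s hs t _ hst => hM.assocFun_mono (hx₀.trans_le hs) hst)
    (fun x hx => (H x hx).2) fun x hx => ?_
  have hx0 := hx₀.trans_le hx
  have h1 := hM.sub_le_counting_mul_log hx0 (Real.exp_pos (2 * K)⁻¹)
  rw [Real.log_exp] at h1
  have h2 := (H (Real.exp (2 * K)⁻¹ * x) (hx.trans (le_mul_of_one_le_left hx0.le hL.le))).1
  have h3 := mul_le_mul_of_nonneg_right h2 (by positivity : 0 ≤ (2 * K)⁻¹)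
  have h4 : K * assocFun M (Real.exp (2 * K)⁻¹ * x) * (2 * K)⁻¹
      = assocFun M (Real.exp (2 * K)⁻¹ * x) / 2 := by field_simp
  linarith

theorem IsWeightSequence.liminf_div_pos_iff (hM : IsWeightSequence M) :
    0 < liminf (fun t : ℝ => ((counting M t / assocFun M t : ℝ) : EReal)) atTop ↔
      ∃ K, 0 < K ∧ ∀ᶠ t in atTop, assocFun M t ≤ K * counting M t := by
  rw [← EReal.coe_zero, lt_liminf_coe_iff]
  constructor
  · rintro ⟨d, hd, h⟩
    refine ⟨d⁻¹, inv_pos.2 hd, ?_⟩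
    filter_upwards [h, hM.eventually_assocFun_pos] with t ht h0
    rw [le_div_iff₀ h0] at ht
    rw [inv_mul_eq_div, le_div_iff₀ hd]
    linarith
  · rintro ⟨K, hK, h⟩
    refine ⟨K⁻¹, inv_pos.2 hK, ?_⟩
    filter_upwards [h, hM.eventually_assocFun_pos] with t ht h0
    rw [le_div_iff₀ h0, inv_mul_eq_div, div_le_iff₀ hK]
    linarith

theorem IsWeightSequence.limsup_div_lt_top_iff (hM : IsWeightSequence M) :
    limsup (fun t : ℝ => ((counting M t / assocFun M t : ℝ) : EReal)) atTop < ⊤ ↔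
      ∃ K, 0 < K ∧ ∀ᶠ t in atTop, counting M t ≤ K * assocFun M t := by
  rw [limsup_coe_lt_top_iff]
  constructor
  · rintro ⟨C, h⟩
    refine ⟨max C 1, by positivity, ?_⟩
    filter_upwards [h, hM.eventually_assocFun_pos] with t ht h0
    rw [div_le_iff₀ h0] at ht
    exact ht.trans (mul_le_mul_of_nonneg_right (le_max_left _ _) h0.le)
  · rintro ⟨K, hK, h⟩
    refine ⟨K, ?_⟩
    filter_upwards [h, hM.eventually_assocFun_pos] with t ht h0
    rwa [div_le_iff₀ h0]

/-! ### Moderate growth -/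

theorem IsWeightSequence.quot_pow_le (hM : IsWeightSequence M) (p n : ℕ) :
    quot M p ^ n * M p ≤ M (p + n) := by
  induction n with
  | zero => simp
  | succ n ih =>
    have h1 : M (p + (n + 1)) = quot M (p + n) * M (p + n) := by
      rw [quot, div_mul_cancel₀ _ (hM.pos _).ne', add_assoc]
    have h2 := hM.monotone_quot (Nat.le_add_right p n)
    have h3 := (hM.quot_pos p).le
    have h4 := (hM.quot_pos (p + n)).le
    have h5 := (hM.pos p).le
    rw [h1, pow_succ', mul_assoc]
    gcongr

/-- Moderate growth gives `(m_p) ^ p ≤ M_{2p} / M_p ≤ A ^ (2p) M_p`, which bounds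
`ω(t) ≤ p log m_p - log M_p` for `p = ν(t)`. -/
theorem IsWeightSequence.assocFun_le_of_moderateGrowth (hM : IsWeightSequence M)
    (h : ModerateGrowth M) :
    ∃ K, 0 < K ∧ ∀ᶠ t in atTop, assocFun M t ≤ K * counting M t := by
  obtain ⟨A, hA, H⟩ := h
  refine ⟨max (2 * Real.log A) 1, by positivity, ?_⟩
  filter_upwards [eventually_gt_atTop 0] with t ht
  obtain ⟨n, hn, htn, hω⟩ := hM.assocFun_eq_counting ht
  rw [hω, hn]
  have h1 : quot M n ^ n ≤ A ^ (n + n) * M n :=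
    le_of_mul_le_mul_right ((hM.quot_pow_le n n).trans (H n n)) (hM.pos n)
  have h2 := Real.log_le_log (pow_pos (hM.quot_pos n) n) h1
  rw [Real.log_mul (pow_pos hA _).ne' (hM.pos n).ne', Real.log_pow, Real.log_pow] at h2
  have h3 := mul_le_mul_of_nonneg_left (Real.log_le_log ht htn.le) (Nat.cast_nonneg (α := ℝ) n)
  have h4 := mul_le_mul_of_nonneg_right (le_max_left (2 * Real.log A) 1)
    (Nat.cast_nonneg (α := ℝ) n)
  push_cast at h2
  linarith

/-- A positive lower power bound gives `2 ω(t) ≤ ω(L t) + B` for all `t > 0`; moderate growth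
follows since `log M_n = n log t - ω(t)` at `t = m_n` and `log M_p ≥ p log s - ω(s)` at
`s = t / L`. -/
theorem IsWeightSequence.moderateGrowth_of_powLower (hM : IsWeightSequence M)
    (h : ∃ b, 0 < b ∧ PowLower (assocFun M) b) : ModerateGrowth M := by
  obtain ⟨L, x₀, hL, hx₀, H⟩ := exists_two_mul_le hM.eventually_assocFun_pos h
  have hL0 : 0 < L := by linarith
  set B := 2 * assocFun M x₀ with hB
  have hB0 : 0 ≤ B := by linarith [hM.assocFun_nonneg hx₀]
  have key : ∀ s, 0 < s → 2 * assocFun M s ≤ assocFun M (L * s) + B := by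
    intro s hs
    rcases le_total x₀ s with hle | hle
    · linarith [(H s hle).2]
    · linarith [hM.assocFun_mono hs hle, hM.assocFun_nonneg (mul_pos hL0 hs)]
  refine ⟨Real.exp B * L, by positivity, fun p q => ?_⟩
  rcases Nat.eq_zero_or_pos (p + q) with h0 | h0
  · obtain ⟨rfl, rfl⟩ : p = 0 ∧ q = 0 := by omega
    simp [hM.zero]
  set n := p + q with hn
  have ht : 0 < quot M n := hM.quot_pos n
  have hω := hM.assocFun_eq ht (p := n) (fun j hj => hM.monotone_quot hj.le) le_rfl
  have hs : 0 < quot M n / L := by positivity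
  have h1 := hM.log_le_assocFun hs p
  have h2 := hM.log_le_assocFun hs q
  have h3 := key _ hs
  rw [mul_div_cancel₀ _ hL0.ne'] at h3
  rw [Real.log_div ht.ne' hL0.ne'] at h1 h2
  have hnc : (n : ℝ) = p + q := by rw [hn]; push_cast; ring
  have hn1 : (1 : ℝ) ≤ n := by exact_mod_cast h0
  have hA : 0 < (Real.exp B * L) ^ n := by positivity
  rw [← Real.log_le_log_iff (hM.pos n) (mul_pos (mul_pos hA (hM.pos p)) (hM.pos q)),
    Real.log_mul (mul_pos hA (hM.pos p)).ne' (hM.pos q).ne', Real.log_mul hA.ne' (hM.pos p).ne',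
    Real.log_pow, Real.log_mul (Real.exp_pos B).ne' hL0.ne', Real.log_exp]
  have h4 : B ≤ n * B := le_mul_of_one_le_left hB0 hn1
  rw [hω, hnc] at h3
  rw [hnc] at h4 ⊢
  linarith

/-! ### Strong nonquasianalyticity -/

theorem IsWeightSequence.term_eq (hM : IsWeightSequence M) (q : ℕ) :
    M q / (((q : ℕ) + 1 : ℝ) * M (q + 1)) = 1 / (((q : ℝ) + 1) * quot M q) := by
  have h1 := (hM.pos q).ne'
  have h2 := (hM.pos (q + 1)).ne'
  rw [quot]
  field_simp

theorem log_le_sum_inv (p n : ℕ) :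
    Real.log (((p : ℝ) + 1 + n) / (p + 1)) ≤
      ∑ i ∈ Finset.range n, 1 / (((p + i : ℕ) : ℝ) + 1) := by
  induction n with
  | zero =>
    have : (p : ℝ) + 1 ≠ 0 := by positivity
    simp [this]
  | succ n ih =>
    rw [Finset.sum_range_succ]
    have h1 : (0 : ℝ) < p + 1 + n := by positivity
    have h2 : (0 : ℝ) < p + 1 := by positivity
    have h3 : ((p : ℝ) + 1 + (n + 1 : ℕ)) / (p + 1)
        = (p + 1 + n) / (p + 1) * (1 + 1 / (p + 1 + n)) := by
      push_cast
      field_simp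
      ring
    rw [h3, Real.log_mul (by positivity) (by positivity)]
    have h4 := Real.log_le_sub_one_of_pos (x := 1 + 1 / ((p : ℝ) + 1 + n)) (by positivity)
    have h5 : 1 / (((p + n : ℕ) : ℝ) + 1) = 1 / ((p : ℝ) + 1 + n) := by
      push_cast
      ring_nf
    rw [h5]
    linarith

/-- The terms of the series with `p ≤ q < k (p + 1) - 1` add up to at least
`log k / m_{k (p + 1) - 1}`, so the quotients at least double from `p` to `k (p + 1) - 1` once
`log k ≥ 2 B`. -/
theorem IsWeightSequence.powLower_of_snq (hM : IsWeightSequence M)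
    (h : StrongNonquasianalytic M) : ∃ b, 0 < b ∧ PowLower (stepFun (quotSeq M)) b := by
  obtain ⟨B, hB, H⟩ := h
  obtain ⟨k, hk⟩ := exists_nat_ge (Real.exp (2 * B))
  have hk1 : (1 : ℝ) < k := (Real.one_lt_exp_iff.2 (by linarith)).trans_le hk
  have hk1' : 1 < k := by exact_mod_cast hk1
  have hlogk : 2 * B ≤ Real.log k := (Real.le_log_iff_exp_le (by linarith)).2 hk
  have key : ∀ p : ℕ, 2 * quot M p ≤ quot M (p + (k - 1) * (p + 1)) := by
    intro p
    set n := (k - 1) * (p + 1) with hn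
    obtain ⟨hs, hle⟩ := H p
    have hterm : ∀ i, 0 ≤ M (p + i) / (((p + i : ℕ) + 1 : ℝ) * M (p + i + 1)) := fun i =>
      div_nonneg (hM.pos _).le (mul_nonneg (by positivity) (hM.pos _).le)
    have h1 := hs.sum_le_tsum (Finset.range n) fun i _ => hterm i
    have h2 : (1 / quot M (p + n)) * ∑ i ∈ Finset.range n, 1 / (((p + i : ℕ) : ℝ) + 1) ≤
        ∑ i ∈ Finset.range n, M (p + i) / (((p + i : ℕ) + 1 : ℝ) * M (p + i + 1)) := by
      rw [Finset.mul_sum]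
      refine Finset.sum_le_sum fun i hi => ?_
      rw [hM.term_eq, one_div_mul_one_div]
      have h3 := hM.quot_pos (p + i)
      have h4 := hM.monotone_quot (Nat.add_le_add_left (Finset.mem_range.1 hi).le p)
      refine one_div_le_one_div_of_le (by positivity) ?_
      rw [mul_comm]
      gcongr
    have h3 := log_le_sum_inv p n
    have h4 : ((p : ℝ) + 1 + n) / (p + 1) = k := by
      rw [hn, Nat.cast_mul, Nat.cast_sub hk1'.le]
      have : (p : ℝ) + 1 ≠ 0 := by positivity
      push_cast
      field_simp
      ring
    rw [h4] at h3
    have hp := hM.quot_pos p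
    have hpn := hM.quot_pos (p + n)
    have h5 : (1 / quot M (p + n)) * (2 * B) ≤ B * (M p / M (p + 1)) := by
      refine le_trans ?_ (h2.trans (h1.trans hle))
      have := hlogk.trans h3
      gcongr
    have h6 : M p / M (p + 1) = 1 / quot M p := by rw [quot, one_div_div]
    rw [h6, one_div_mul_eq_div, mul_one_div, div_le_div_iff₀ hpn hp] at h5
    nlinarith
  refine exists_powLower_of_mul_le (x₀ := 1) one_pos hk1 one_lt_two
    (hM.monotone_stepFun.monotoneOn _) (fun x _ => hM.stepFun_pos x) fun x hx => ?_
  have hf1 : 1 ≤ ⌊x⌋₊ := Nat.le_floor (by exact_mod_cast hx)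
  refine (key (⌊x⌋₊ - 1)).trans (hM.monotone_quot ?_)
  have h1 : k * ⌊x⌋₊ ≤ ⌊(k : ℝ) * x⌋₊ := by
    refine Nat.le_floor ?_
    push_cast
    gcongr
    exact Nat.floor_le (by linarith)
  have h2 : ⌊x⌋₊ - 1 + (k - 1) * (⌊x⌋₊ - 1 + 1) = k * ⌊x⌋₊ - 1 := by
    rw [Nat.sub_add_cancel hf1, Nat.sub_mul, one_mul]
    have := Nat.le_mul_of_pos_left ⌊x⌋₊ (by omega : 0 < k)
    omega
  rw [h2]
  exact Nat.sub_le_sub_right h1 1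

theorem inv_mul_rpow_le_sub {b x : ℝ} (hb : 0 < b) (hx : 1 ≤ x) :
    x⁻¹ * x ^ (-b) ≤ (2 / b + 1) * (x ^ (-b) - (x + 1) ^ (-b)) := by
  have hx0 : 0 < x := by linarith
  have hxb : 0 < x ^ (-b) := Real.rpow_pos_of_pos hx0 _
  set h := x⁻¹ with hh
  have hh0 : 0 < h := inv_pos.2 hx0
  have hh1 : h ≤ 1 := inv_le_one_of_one_le₀ hx
  have h1 : (x + 1) ^ (-b) = x ^ (-b) * (1 + h) ^ (-b) := by
    rw [← Real.mul_rpow hx0.le (by positivity)]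
    congr 1
    rw [hh]
    field_simp
  have h2 : h / 2 ≤ Real.log (1 + h) := by
    have h3 := Real.one_sub_inv_le_log_of_pos (x := 1 + h) (by positivity)
    have h4 : 1 - (1 + h)⁻¹ = h / (1 + h) := by field_simp; ring
    rw [h4] at h3
    refine le_trans ?_ h3
    gcongr
    linarith
  have h3 : (1 + h) ^ (-b) ≤ 1 / (1 + b * h / 2) := by
    rw [Real.rpow_neg (by positivity), ← one_div]
    refine one_div_le_one_div_of_le (by positivity) ?_
    rw [Real.rpow_def_of_pos (by positivity)]
    have := Real.add_one_le_exp (Real.log (1 + h) * b)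
    nlinarith
  have h4 : h ≤ (2 / b + 1) * (1 - (1 + h) ^ (-b)) := by
    have h5 : h ≤ (2 / b + 1) * (1 - 1 / (1 + b * h / 2)) := by
      have h6 : (2 / b + 1) * (1 - 1 / (1 + b * h / 2)) = h * ((2 + b) / (2 + b * h)) := by
        field_simp
        ring
      rw [h6]
      refine le_mul_of_one_le_right hh0.le ((one_le_div (by positivity)).2 ?_)
      nlinarith
    refine h5.trans ?_
    gcongr
  rw [h1]
  nlinarith

/-- Lower power bounds of the quotients hold from the first index on, at the cost of the
constant. -/
theorem IsWeightSequence.exists_quot_lower (hM : IsWeightSequence M) {b : ℝ} (hb : 0 < b)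
    (h : PowLower (stepFun (quotSeq M)) b) :
    ∃ D, 0 < D ∧ ∀ p q : ℕ, p ≤ q →
      D * (((q : ℝ) + 1) / (p + 1)) ^ b * quot M p ≤ quot M q := by
  obtain ⟨D, x₀, hD, hx₀, H⟩ := h
  obtain ⟨N, hN⟩ := exists_nat_ge x₀
  have H' : ∀ p q : ℕ, N ≤ p → p ≤ q → D * (((q : ℝ) + 1) / (p + 1)) ^ b * quot M p ≤ quot M q := by
    intro p q hp hpq
    have hp' : (N : ℝ) ≤ p := by exact_mod_cast hp
    have hpq' : (p : ℝ) ≤ q := by exact_mod_cast hpq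
    have h1 := H ((p : ℝ) + 1) (by linarith) (((q : ℝ) + 1) / (p + 1))
      ((one_le_div (by positivity)).2 (by linarith))
    rwa [div_mul_cancel₀ _ (by positivity), stepFun_quotSeq_add_one,
      stepFun_quotSeq_add_one] at h1
  have hNb : 1 ≤ ((N : ℝ) + 1) ^ b := Real.one_le_rpow (by linarith [N.cast_nonneg (α := ℝ)]) hb.le
  refine ⟨min D 1 / ((N : ℝ) + 1) ^ b, by positivity, fun p q hpq => ?_⟩
  have hp0 := hM.quot_pos p
  have hpq' : (p : ℝ) ≤ q := by exact_mod_cast hpq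
  have hdiv : min D 1 / ((N : ℝ) + 1) ^ b ≤ D := by
    refine (div_le_self (by positivity) hNb).trans (min_le_left _ _)
  rcases le_total N p with hp | hp
  · refine le_trans ?_ (H' p q hp hpq)
    gcongr
  -- For `p ≤ N` the ratio `(q + 1) / (p + 1)` is compared with `(q + 1) / (N + 1)`.
  have h1 : ((q : ℝ) + 1) / (p + 1) ≤ (N + 1) * (((q : ℝ) + 1) / (N + 1)) := by
    rw [mul_div_cancel₀ _ (by positivity)]
    exact div_le_self (by positivity) (by linarith [p.cast_nonneg (α := ℝ)])
  have h2 : (((q : ℝ) + 1) / (p + 1)) ^ b ≤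
      ((N : ℝ) + 1) ^ b * (((q : ℝ) + 1) / (N + 1)) ^ b := by
    rw [← Real.mul_rpow (by positivity) (by positivity)]
    exact Real.rpow_le_rpow (by positivity) h1 hb.le
  have h3 : min D 1 / ((N : ℝ) + 1) ^ b * (((q : ℝ) + 1) / (p + 1)) ^ b * quot M p ≤
      min D 1 * (((q : ℝ) + 1) / (N + 1)) ^ b * quot M p := by
    have : min D 1 / ((N : ℝ) + 1) ^ b * (((q : ℝ) + 1) / (p + 1)) ^ b ≤
        min D 1 * (((q : ℝ) + 1) / (N + 1)) ^ b := by
      rw [div_mul_eq_mul_div, div_le_iff₀ (by positivity), mul_assoc]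
      gcongr
      linarith
    gcongr
  refine h3.trans ?_
  rcases le_total N q with hq | hq
  · refine le_trans ?_ (H' N q le_rfl hq)
    have := hM.monotone_quot hp
    gcongr
    exact min_le_left _ _
  · have h4 : (((q : ℝ) + 1) / (N + 1)) ^ b ≤ 1 := by
      have hq' : (q : ℝ) ≤ N := by exact_mod_cast hq
      refine Real.rpow_le_one (by positivity) ((div_le_one (by positivity)).2 (by linarith)) hb.le
    have h5 : min D 1 * (((q : ℝ) + 1) / (N + 1)) ^ b ≤ 1 :=
      mul_le_one₀ (min_le_right _ _) (by positivity) h4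
    calc _ ≤ 1 * quot M p := by gcongr
      _ ≤ quot M q := by rw [one_mul]; exact hM.monotone_quot hpq

/-- By a lower power bound with exponent `b` the series is dominated by the sum of
`(q + 1) ^ (-1 - b)`, which in turn is dominated by a telescoping series of `(q + 1) ^ (-b)`. -/
theorem IsWeightSequence.snq_of_powLower (hM : IsWeightSequence M)
    (h : ∃ b, 0 < b ∧ PowLower (stepFun (quotSeq M)) b) : StrongNonquasianalytic M := by
  obtain ⟨b, hb, h⟩ := h
  obtain ⟨D, hD, H⟩ := hM.exists_quot_lower hb h
  set K := 2 / b + 1 with hK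
  have hK0 : 0 < K := by positivity
  refine ⟨K / D, by positivity, fun p => ?_⟩
  have hp := hM.quot_pos p
  have hnn : ∀ i, 0 ≤ M (p + i) / (((p + i : ℕ) + 1 : ℝ) * M (p + i + 1)) := fun i =>
    div_nonneg (hM.pos _).le (mul_nonneg (by positivity) (hM.pos _).le)
  set g : ℕ → ℝ := fun i => K * ((p : ℝ) + 1) ^ b / (D * quot M p) *
    (((p + i : ℕ) : ℝ) + 1) ^ (-b) with hg
  have hterm : ∀ i, M (p + i) / (((p + i : ℕ) + 1 : ℝ) * M (p + i + 1)) ≤ g i - g (i + 1) := by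
    intro i
    rw [hM.term_eq]
    set x : ℝ := ((p + i : ℕ) : ℝ) + 1 with hx
    have hx1 : 1 ≤ x := by rw [hx]; linarith [(p + i).cast_nonneg (α := ℝ)]
    have hx0 : 0 < x := by linarith
    have hxs : ((p + (i + 1) : ℕ) : ℝ) + 1 = x + 1 := by rw [hx]; push_cast; ring
    have h1 := H p (p + i) (Nat.le_add_right p i)
    rw [← hx, Real.div_rpow hx0.le (by positivity)] at h1
    have h2 := inv_mul_rpow_le_sub hb hx1
    rw [← hK] at h2
    have hxb : 0 < x ^ b := Real.rpow_pos_of_pos hx0 b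
    have hpb : 0 < ((p : ℝ) + 1) ^ b := by positivity
    have h3 : 1 / (x * quot M (p + i)) ≤
        ((p : ℝ) + 1) ^ b / (D * quot M p) * (x⁻¹ * x ^ (-b)) := by
      rw [Real.rpow_neg hx0.le]
      calc 1 / (x * quot M (p + i))
          ≤ 1 / (x * (D * (x ^ b / ((p : ℝ) + 1) ^ b) * quot M p)) := by
            refine one_div_le_one_div_of_le (by positivity) ?_
            gcongr
        _ = _ := by field_simp
    refine h3.trans ?_
    calc ((p : ℝ) + 1) ^ b / (D * quot M p) * (x⁻¹ * x ^ (-b))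
        ≤ ((p : ℝ) + 1) ^ b / (D * quot M p) * (K * (x ^ (-b) - (x + 1) ^ (-b))) := by gcongr
      _ = g i - g (i + 1) := by
        simp only [hg, hxs, ← hx]
        ring
  have hsum : ∀ n, ∑ i ∈ Finset.range n,
      M (p + i) / (((p + i : ℕ) + 1 : ℝ) * M (p + i + 1)) ≤ K / D * (M p / M (p + 1)) := by
    intro n
    refine (Finset.sum_le_sum fun i _ => hterm i).trans ?_
    rw [Finset.sum_range_sub']
    have hgn : 0 ≤ g n := by simp only [hg]; positivity
    have hg0 : g 0 = K / D * (M p / M (p + 1)) := by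
      have h6 : M p / M (p + 1) = 1 / quot M p := by rw [quot, one_div_div]
      have hpb : ((p : ℝ) + 1) ^ b ≠ 0 := by positivity
      simp only [hg, add_zero]
      rw [h6, Real.rpow_neg (by positivity)]
      field_simp
    linarith
  exact ⟨summable_of_sum_range_le hnn hsum, Real.tsum_le_of_sum_range_le hnn hsum⟩

/-! ### O-regular variation and the quotients `m_{kp} / m_p` -/

theorem IsWeightSequence.oRegularlyVarying_iff (hM : IsWeightSequence M) :
    SeqORegularlyVarying (quotSeq M) ↔ ∃ a, 0 < a ∧ PowUpper (stepFun (quotSeq M)) a := by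
  constructor
  · intro h
    obtain ⟨C, hC⟩ := limsup_coe_lt_top_iff.1 (h 3 (by norm_num))
    obtain ⟨N, hN⟩ := eventually_atTop.1 hC
    refine exists_powUpper_of_le_mul (x₀ := N + 1) (L := 2) (K := C) (by positivity) one_lt_two
      (hM.monotone_stepFun.monotoneOn _) (fun x _ => hM.stepFun_pos x) fun x hx => ?_
    have hNx : N + 1 ≤ ⌊x⌋₊ := Nat.le_floor (by exact_mod_cast hx)
    have h1 := hN ⌊x⌋₊ (by omega)
    have h2 : ⌊3 * (⌊x⌋₊ : ℝ)⌋₊ = 3 * ⌊x⌋₊ := by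
      have : (3 * (⌊x⌋₊ : ℝ)) = ((3 * ⌊x⌋₊ : ℕ) : ℝ) := by push_cast; ring
      rw [this, Nat.floor_natCast]
    rw [h2, div_le_iff₀ (hM.quotSeq_pos _)] at h1
    refine (hM.monotone_quotSeq ?_).trans h1
    have h3 : ⌊2 * x⌋₊ < 2 * ⌊x⌋₊ + 2 := by
      refine (Nat.floor_lt' (by omega)).2 ?_
      push_cast
      linarith [Nat.lt_floor_add_one x]
    omega
  · intro h l hl
    obtain ⟨K, x₀, hK, hx₀, H⟩ := exists_le_mul_of_powUpper h (le_max_right l 1)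
    refine limsup_coe_lt_top_iff.2 ⟨K, ?_⟩
    obtain ⟨N, hN⟩ := exists_nat_ge x₀
    filter_upwards [eventually_ge_atTop N] with p hp
    rw [div_le_iff₀ (hM.quotSeq_pos _)]
    have h1 := H p (hN.trans (by exact_mod_cast hp))
    rw [stepFun_natCast] at h1
    refine le_trans ?_ h1
    exact hM.monotone_stepFun (mul_le_mul_of_nonneg_right (le_max_left _ _) p.cast_nonneg)

theorem IsWeightSequence.exists_quot_ratio_iff (hM : IsWeightSequence M) :
    (∃ k : ℕ, 2 ≤ k ∧ (∃ d, 1 < d ∧ ∀ᶠ p in atTop, d ≤ quot M (k * p) / quot M p) ∧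
      ∃ C, ∀ᶠ p in atTop, quot M (k * p) / quot M p ≤ C) ↔
    (∃ a, 0 < a ∧ PowUpper (stepFun (quotSeq M)) a) ∧
      ∃ b, 0 < b ∧ PowLower (stepFun (quotSeq M)) b := by
  constructor
  · rintro ⟨k, hk, ⟨d, hd, h₁⟩, C, h₂⟩
    obtain ⟨N, hN⟩ := eventually_atTop.1 (h₁.and h₂)
    constructor
    · refine exists_powUpper_of_le_mul (x₀ := N + 2) (L := 2) (K := max C 1 * max C 1)
        (by positivity) one_lt_two
        (hM.monotone_stepFun.monotoneOn _) (fun x _ => hM.stepFun_pos x) fun x hx => ?_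
      have hNx : N + 2 ≤ ⌊x⌋₊ := Nat.le_floor (by exact_mod_cast hx)
      set n := ⌊x⌋₊ - 1 with hn
      have hC : ∀ p, N ≤ p → quot M (k * p) ≤ max C 1 * quot M p := fun p hp => by
        have h1 := (hN p hp).2
        rw [div_le_iff₀ (hM.quot_pos _)] at h1
        exact h1.trans (mul_le_mul_of_nonneg_right (le_max_left _ _) (hM.quot_pos _).le)
      have hkn : n ≤ k * n := Nat.le_mul_of_pos_left n (by omega)
      have h1 := hC n (by omega)
      have h2 := hC (k * n) (by omega)
      have h3 : ⌊2 * x⌋₊ < 2 * ⌊x⌋₊ + 2 := by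
        refine (Nat.floor_lt' (by omega)).2 ?_
        push_cast
        linarith [Nat.lt_floor_add_one x]
      have h4 : 2 * (2 * n) ≤ k * (k * n) :=
        Nat.mul_le_mul hk (Nat.mul_le_mul_right n hk)
      have h5 : stepFun (quotSeq M) (2 * x) ≤ quot M (k * (k * n)) :=
        hM.monotone_quot (by omega)
      have h6 : stepFun (quotSeq M) x = quot M n := rfl
      rw [h6, mul_assoc]
      exact h5.trans (h2.trans (mul_le_mul_of_nonneg_left h1 (by positivity)))
    · refine exists_powLower_of_mul_le (x₀ := N + 1) (L := k) (by positivity)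
        (by exact_mod_cast hk) hd
        (hM.monotone_stepFun.monotoneOn _) (fun x _ => hM.stepFun_pos x) fun x hx => ?_
      have hNx : N + 1 ≤ ⌊x⌋₊ := Nat.le_floor (by exact_mod_cast hx)
      have h1 := (hN (⌊x⌋₊ - 1) (by omega)).1
      rw [le_div_iff₀ (hM.quot_pos _)] at h1
      refine h1.trans (hM.monotone_quot ?_)
      have h2 : k * ⌊x⌋₊ ≤ ⌊(k : ℝ) * x⌋₊ := by
        refine Nat.le_floor ?_
        push_cast
        gcongr
        refine Nat.floor_le ?_
        have : (0 : ℝ) ≤ N := by positivity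
        linarith
      rw [Nat.mul_sub, mul_one]
      omega
  · rintro ⟨hU, hL⟩
    obtain ⟨L, x₀, hL1, hx₀, H⟩ := exists_two_mul_le hM.eventually_stepFun_pos hL
    obtain ⟨k, hk⟩ := exists_nat_ge (2 * L)
    have hk2 : (2 : ℝ) < k := by linarith
    have hk2' : 2 < k := by exact_mod_cast hk2
    obtain ⟨K, x₁, hK, hx₁, H'⟩ := exists_le_mul_of_powUpper hU (L := k) (by linarith)
    refine ⟨k, hk2'.le, ⟨2, one_lt_two, ?_⟩, K, ?_⟩
    · obtain ⟨N, hN⟩ := exists_nat_ge x₀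
      filter_upwards [eventually_ge_atTop N, eventually_ge_atTop 1] with p hp hp1
      have hp' : (N : ℝ) ≤ p := by exact_mod_cast hp
      have hp1' : (1 : ℝ) ≤ p := by exact_mod_cast hp1
      have h1 := (H ((p : ℝ) + 1) (by linarith)).2
      rw [stepFun_quotSeq_add_one] at h1
      rw [le_div_iff₀ (hM.quot_pos _), ← stepFun_quotSeq_add_one (k * p)]
      refine h1.trans (hM.monotone_stepFun ?_)
      push_cast
      nlinarith
    · obtain ⟨N, hN⟩ := exists_nat_ge x₁
      filter_upwards [eventually_ge_atTop N] with p hp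
      have hp' : (N : ℝ) ≤ p := by exact_mod_cast hp
      have h1 := H' ((p : ℝ) + 1) (by linarith)
      rw [stepFun_quotSeq_add_one] at h1
      rw [div_le_iff₀ (hM.quot_pos _), ← stepFun_quotSeq_add_one (k * p)]
      refine le_trans (hM.monotone_stepFun ?_) h1
      push_cast
      nlinarith

/-! ### The equivalences -/

theorem IsWeightSequence.exists_powUpper_counting_iff (hM : IsWeightSequence M) :
    (∃ a, 0 < a ∧ PowUpper (counting M) a) ↔
      ∃ b, 0 < b ∧ PowLower (stepFun (quotSeq M)) b :=
  ⟨fun ⟨_, ha, h⟩ => ⟨_, inv_pos.2 ha, hM.powLower_stepFun ha h⟩,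
    fun ⟨_, hb, h⟩ => ⟨_, inv_pos.2 hb, hM.powUpper_counting hb h⟩⟩

theorem IsWeightSequence.exists_powLower_counting_iff (hM : IsWeightSequence M) :
    (∃ b, 0 < b ∧ PowLower (counting M) b) ↔
      ∃ a, 0 < a ∧ PowUpper (stepFun (quotSeq M)) a :=
  ⟨fun ⟨_, hb, h⟩ => ⟨_, inv_pos.2 hb, hM.powUpper_stepFun hb h⟩,
    fun ⟨_, ha, h⟩ => ⟨_, inv_pos.2 ha, hM.powLower_counting ha h⟩⟩

theorem IsWeightSequence.moderateGrowth_iff (hM : IsWeightSequence M) :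
    ModerateGrowth M ↔ ∃ a, 0 < a ∧ PowUpper (stepFun (quotSeq M)) a := by
  rw [← hM.exists_powLower_counting_iff]
  exact ⟨fun h => hM.powLower_counting_of_le (hM.assocFun_le_of_moderateGrowth h),
    fun h => hM.moderateGrowth_of_powLower
      (hM.powLower_assocFun_of_le (hM.assocFun_le_of_powLower_counting h))⟩

theorem IsWeightSequence.snq_iff (hM : IsWeightSequence M) :
    StrongNonquasianalytic M ↔ ∃ b, 0 < b ∧ PowLower (stepFun (quotSeq M)) b :=
  ⟨hM.powLower_of_snq, hM.snq_of_powLower⟩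

theorem IsWeightSequence.isStronglyRegular_iff (hM : IsWeightSequence M) :
    IsStronglyRegular M ↔ (∃ a, 0 < a ∧ PowUpper (stepFun (quotSeq M)) a) ∧
      ∃ b, 0 < b ∧ PowLower (stepFun (quotSeq M)) b := by
  rw [← hM.moderateGrowth_iff, ← hM.snq_iff]
  exact ⟨fun h => ⟨h.moderateGrowth, h.snq⟩,
    fun h => ⟨hM.pos, hM.zero, hM.logConvex, h.1, h.2⟩⟩

/-- The two indices of the counting function are positive and finite exactly if it is comparable
with the associated function. -/
theorem IsWeightSequence.powBounds_counting_iff (hM : IsWeightSequence M) :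
    ((∃ a, 0 < a ∧ PowUpper (counting M) a) ∧ ∃ b, 0 < b ∧ PowLower (counting M) b) ↔
      (∃ K, 0 < K ∧ ∀ᶠ t in atTop, assocFun M t ≤ K * counting M t) ∧
        ∃ K, 0 < K ∧ ∀ᶠ t in atTop, counting M t ≤ K * assocFun M t := by
  constructor
  · rintro ⟨hU, hL⟩
    exact ⟨hM.assocFun_le_of_powLower_counting hL, hM.counting_le_of_powUpper_counting hU⟩
  · rintro ⟨hA, hB⟩
    refine ⟨?_, hM.powLower_counting_of_le hA⟩
    obtain ⟨a, ha, h⟩ := hM.powUpper_assocFun_of_le hB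
    obtain ⟨K, hK, hA⟩ := hA
    obtain ⟨K', hK', hB⟩ := hB
    exact ⟨a, ha, h.of_comparable hK hK' hB hA⟩

theorem IsWeightSequence.powBounds_assocFun_iff (hM : IsWeightSequence M) :
    ((∃ a, 0 < a ∧ PowUpper (assocFun M) a) ∧ ∃ b, 0 < b ∧ PowLower (assocFun M) b) ↔
      (∃ K, 0 < K ∧ ∀ᶠ t in atTop, assocFun M t ≤ K * counting M t) ∧
        ∃ K, 0 < K ∧ ∀ᶠ t in atTop, counting M t ≤ K * assocFun M t :=
  ⟨fun ⟨hU, hL⟩ => ⟨hM.assocFun_le_of_powLower_assocFun hL,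
      hM.counting_le_of_powUpper_assocFun hU⟩,
    fun ⟨hA, hB⟩ => ⟨hM.powUpper_assocFun_of_le hB, hM.powLower_assocFun_of_le hA⟩⟩

theorem IsWeightSequence.upperIndex_counting (hM : IsWeightSequence M)
    (hU : ∃ a, 0 < a ∧ PowUpper (stepFun (quotSeq M)) a)
    (hL : ∃ b, 0 < b ∧ PowLower (stepFun (quotSeq M)) b) :
    upperIndex (counting M) = 1 / seqLowerIndex (quotSeq M) := by
  obtain ⟨a, -, ha⟩ := hU
  obtain ⟨r, hr, h1, h2⟩ := exists_lowerIndex_upperIndex_inv (f := counting M)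
    (g := stepFun (quotSeq M)) hM.eventually_counting_pos hM.eventually_stepFun_pos
    (fun b hb => ⟨hM.powUpper_counting hb, fun h => by
      simpa using hM.powLower_stepFun (inv_pos.2 hb) h⟩) hL ⟨a, ha⟩
  rw [seqLowerIndex, h1, h2, one_div, EReal.coe_inv]

theorem IsWeightSequence.lowerIndex_counting (hM : IsWeightSequence M)
    (hU : ∃ a, 0 < a ∧ PowUpper (stepFun (quotSeq M)) a)
    (hL : ∃ b, 0 < b ∧ PowLower (stepFun (quotSeq M)) b) :
    lowerIndex (counting M) = 1 / seqUpperIndex (quotSeq M) := by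
  obtain ⟨a, -, ha⟩ := hM.exists_powUpper_counting_iff.2 hL
  obtain ⟨r, hr, h1, h2⟩ := exists_lowerIndex_upperIndex_inv (f := stepFun (quotSeq M))
    (g := counting M) hM.eventually_stepFun_pos hM.eventually_counting_pos
    (fun b hb => ⟨hM.powUpper_stepFun hb, fun h => by
      simpa using hM.powLower_counting (inv_pos.2 hb) h⟩)
    (hM.exists_powLower_counting_iff.2 hU) ⟨a, ha⟩
  rw [seqUpperIndex, h1, h2, one_div, ← EReal.coe_inv, inv_inv]

end WeightSeq

theorem corollary4p10 (M : ℕ → ℝ) (hM : WeightSeq.IsWeightSequence M) :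
    List.TFAE [
      WeightSeq.IsStronglyRegular M,
      ∃ k : ℕ, 2 ≤ k ∧
        1 < liminf (fun p : ℕ =>
          ((WeightSeq.quot M (k * p) / WeightSeq.quot M p : ℝ) : EReal)) atTop ∧
        liminf (fun p : ℕ =>
          ((WeightSeq.quot M (k * p) / WeightSeq.quot M p : ℝ) : EReal)) atTop ≤
        limsup (fun p : ℕ =>
          ((WeightSeq.quot M (k * p) / WeightSeq.quot M p : ℝ) : EReal)) atTop ∧
        limsup (fun p : ℕ =>
          ((WeightSeq.quot M (k * p) / WeightSeq.quot M p : ℝ) : EReal)) atTop < ⊤,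
      WeightSeq.seqUpperIndex (WeightSeq.quotSeq M) < ⊤ ∧
        0 < WeightSeq.seqLowerIndex (WeightSeq.quotSeq M),
      WeightSeq.SeqORegularlyVarying (WeightSeq.quotSeq M) ∧
        0 < WeightSeq.seqLowerIndex (WeightSeq.quotSeq M),
      0 < liminf (fun t : ℝ =>
          ((WeightSeq.counting M t / WeightSeq.assocFun M t : ℝ) : EReal)) atTop ∧
        liminf (fun t : ℝ =>
          ((WeightSeq.counting M t / WeightSeq.assocFun M t : ℝ) : EReal)) atTop ≤
        limsup (fun t : ℝ =>
          ((WeightSeq.counting M t / WeightSeq.assocFun M t : ℝ) : EReal)) atTop ∧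
        limsup (fun t : ℝ =>
          ((WeightSeq.counting M t / WeightSeq.assocFun M t : ℝ) : EReal)) atTop < ⊤,
      WeightSeq.upperIndex (WeightSeq.counting M) < ⊤ ∧
        0 < WeightSeq.lowerIndex (WeightSeq.counting M),
      WeightSeq.upperIndex (WeightSeq.assocFun M) < ⊤ ∧
        0 < WeightSeq.lowerIndex (WeightSeq.assocFun M)] ∧
    (WeightSeq.IsStronglyRegular M →
      (WeightSeq.upperIndex (WeightSeq.assocFun M) =
          WeightSeq.upperIndex (WeightSeq.counting M) ∧
        WeightSeq.upperIndex (WeightSeq.counting M) =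
          1 / WeightSeq.seqLowerIndex (WeightSeq.quotSeq M)) ∧
      (WeightSeq.lowerIndex (WeightSeq.assocFun M) =
          WeightSeq.lowerIndex (WeightSeq.counting M) ∧
        WeightSeq.lowerIndex (WeightSeq.counting M) =
          1 / WeightSeq.seqUpperIndex (WeightSeq.quotSeq M))) := by
  have hω := hM.eventually_assocFun_pos
  have hν := hM.eventually_counting_pos
  have hm := hM.eventually_stepFun_pos
  have h1 := hM.isStronglyRegular_iff
  have h6 : (∃ a, 0 < a ∧ WeightSeq.PowUpper (WeightSeq.stepFun (WeightSeq.quotSeq M)) a) ∧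
      (∃ b, 0 < b ∧ WeightSeq.PowLower (WeightSeq.stepFun (WeightSeq.quotSeq M)) b) ↔
      (∃ a, 0 < a ∧ WeightSeq.PowUpper (WeightSeq.counting M) a) ∧
        ∃ b, 0 < b ∧ WeightSeq.PowLower (WeightSeq.counting M) b := by
    rw [hM.exists_powUpper_counting_iff, hM.exists_powLower_counting_iff, and_comm]
  have hle : ∀ u : ℕ → EReal, liminf u atTop ≤ limsup u atTop := fun _ => liminf_le_limsup
  have hle' : ∀ u : ℝ → EReal, liminf u atTop ≤ limsup u atTop := fun _ => liminf_le_limsup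
  constructor
  · simp only [hle, hle', true_and]
    rw [WeightSeq.upperIndex_lt_top_iff hν, WeightSeq.lowerIndex_pos_iff hν,
      WeightSeq.upperIndex_lt_top_iff hω, WeightSeq.lowerIndex_pos_iff hω,
      WeightSeq.seqUpperIndex, WeightSeq.seqLowerIndex,
      WeightSeq.upperIndex_lt_top_iff hm, WeightSeq.lowerIndex_pos_iff hm,
      hM.liminf_div_pos_iff, hM.limsup_div_lt_top_iff, hM.oRegularlyVarying_iff,
      hM.powBounds_assocFun_iff, ← hM.powBounds_counting_iff, ← h6, h1]
    simp only [← EReal.coe_one, WeightSeq.lt_liminf_coe_iff, WeightSeq.limsup_coe_lt_top_iff]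
    rw [hM.exists_quot_ratio_iff]
    simp
  · intro hreg
    obtain ⟨hU, hL⟩ := h1.1 hreg
    obtain ⟨⟨K, hK, hA⟩, K', hK', hB⟩ := hM.powBounds_counting_iff.1 (h6.1 ⟨hU, hL⟩)
    exact ⟨⟨WeightSeq.upperIndex_congr hω hν hK hK' hB hA, hM.upperIndex_counting hU hL⟩,
      WeightSeq.lowerIndex_congr hω hν hK hK' hB hA, hM.lowerIndex_counting hU hL⟩
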